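/- There is an absolute constant $C>0$ such that the following holds. Let $1\le m\le n$ and $k\ge 0$ be integers, and let $\mathcal A=(A_1,\dots,A_k)$ with $A_i\in\mathbb R^{m\times n}$ for $1\le i\le k$. Write $s=s(\mathcal A):=\sum_{i=1}^k\|A_i\|_F^2$. Let $\epsilon\ge 0$ and $\lambda>0$ be real numbers such that: (1) ($\mathcal A$ is $\epsilon$-nearly doubly balanced) in the positive semidefinite order, \[ (1-\epsilon)\frac{s}{m}I_m\preceq\sum_{i=1}^kA_iA_i^*\preceq(1+\epsilon)\frac{s}{m}I_m \quad\text{and}\quad (1-\epsilon)\frac{s}{n}I_n\preceq\sum_{i=1}^kA_i^*A_i\preceq(1+\epsilon)\frac{s}{n}I_n; \] (2) ($\mathcal A$ has a $\lambda$-spectral gap) $\sigma_2(M_{\mathcal A})\le(1-\lambda)\dfrac{s}{\sqrt{mn}}$, where $\sigma_2(M_{\mathcal A})$ is the second largest singular value, counted with multiplicity and taken to be $0$ if there is none, of the $m^2\times n^2$ matrix $M_{\mathcal A}:=\sum_{i=1}^kA_i\otimes A_i$; (3) $\lambda^2\ge C\,\epsilon\log m$. Then the capacity \[ \operatorname{cap}(\mathcal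 A):=\inf_{X\succ0}\frac{m\,\det\big(\sum_{i=1}^kA_iXA_i^*\big)^{1/m}}{\det(X)^{1/n}}, \] where $X$ ranges over the real symmetric positive definite $n\times n$ matrices, satisfies \[ s(\mathcal A)\ \ge\ \operatorname{cap}(\mathcal A)\ \ge\ \Big(1-\frac{4\epsilon^2}{\lambda}\Big)s(\mathcal A). \] -/

import Mathlib

open scoped Matrix Kronecker

namespace OperatorScaling

/-- An operator is a tuple `(A₁, …, A_k)` of real `m × n` matrices. -/
abbrev Operator (k m n : ℕ) : Type := Fin k → Matrix (Fin m) (Fin n) ℝ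

variable {k m n : ℕ}

/-- The completely positive map `Φ(Y) = ∑ᵢ Aᵢ Y Aᵢ*`. -/
def cpMap (A : Operator k m n) (Y : Matrix (Fin n) (Fin n) ℝ) : Matrix (Fin m) (Fin m) ℝ :=
  ∑ i, A i * Y * (A i)ᵀ

/-- The adjoint map `Φ*(X) = ∑ᵢ Aᵢ* X Aᵢ`. -/
def cpMapAdjoint (A : Operator k m n) (X : Matrix (Fin m) (Fin m) ℝ) :
    Matrix (Fin n) (Fin n) ℝ :=
  ∑ i, (A i)ᵀ * X * A i

/-- The size `s(A)`: the sum of the squared Frobenius norms of the matrices `Aᵢ`. -/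
def size (A : Operator k m n) : ℝ := ∑ i, ∑ a, ∑ b, A i a b ^ 2

/-- `A` is `ε`-nearly doubly balanced: in the Loewner order,
`(1 - ε) (s/m) I ≤ Φ(I) ≤ (1 + ε) (s/m) I` and `(1 - ε) (s/n) I ≤ Φ*(I) ≤ (1 + ε) (s/n) I`. -/
structure IsNearlyDoublyBalanced (A : Operator k m n) (ε : ℝ) : Prop where
  left_lower : (cpMap A 1 - ((1 - ε) * (size A / m)) • 1).PosSemidef
  left_upper : (((1 + ε) * (size A / m)) • 1 - cpMap A 1).PosSemidef
  right_lower : (cpMapAdjoint A 1 - ((1 - ε) * (size A / n)) • 1).PosSemidef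
  right_upper : (((1 + ε) * (size A / n)) • 1 - cpMapAdjoint A 1).PosSemidef

/-- The `m² × n²` matrix `M_A = ∑ᵢ Aᵢ ⊗ Aᵢ`. -/
def matrixRep (A : Operator k m n) : Matrix (Fin m × Fin m) (Fin n × Fin n) ℝ :=
  ∑ i, A i ⊗ₖ A i

/-- The second largest singular value of a real matrix, counted with multiplicity (the sequence
`LinearMap.singularValues` is non-increasing and starts at index `0`). It is `0` for a matrix
of rank at most one. -/
noncomputable def sigmaTwo {p q : Type*} [Fintype p] [DecidableEq p] [Fintype q] [DecidableEq q]
    (M : Matrix p q ℝ) : ℝ :=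
  (Matrix.toEuclideanLin M).singularValues 1

/-- `A` has a `lam`-spectral gap: `σ₂(M_A) ≤ (1 - lam) s(A) / √(mn)`. -/
def HasSpectralGap (A : Operator k m n) (lam : ℝ) : Prop :=
  sigmaTwo (matrixRep A) ≤ (1 - lam) * (size A / √((m : ℝ) * n))

/-- The capacity of `A`: the infimum over positive definite `X` of
`m det(Φ(X))^(1/m) / det(X)^(1/n)`. -/
noncomputable def capacity (A : Operator k m n) : ℝ :=
  ⨅ X : {X : Matrix (Fin n) (Fin n) ℝ // X.PosDef},
    m * (cpMap A X.1).det ^ (1 / (m : ℝ)) / X.1.det ^ (1 / (n : ℝ))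

/-- The set whose infimum is the capacity is bounded below (and it is visibly nonempty), so that
the capacity is a genuine infimum. -/
theorem capacity_bddBelow (A : Operator k m n) :
    BddBelow (Set.range fun X : {X : Matrix (Fin n) (Fin n) ℝ // X.PosDef} =>
      m * (cpMap A X.1).det ^ (1 / (m : ℝ)) / X.1.det ^ (1 / (n : ℝ))) := by
  refine ⟨0, ?_⟩
  rintro _ ⟨X, rfl⟩
  have h1 : (cpMap A X.1).PosSemidef := by
    unfold cpMap
    refine Matrix.posSemidef_sum _ fun i _ => ?_
    have := X.2.posSemidef.mul_mul_conjTranspose_same (A i)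
    rwa [Matrix.conjTranspose_eq_transpose_of_trivial] at this
  have h2 := h1.det_nonneg
  have h3 := X.2.det_pos
  dsimp only
  positivity

end OperatorScaling

/-!
After normalization, `Φ` and its adjoint `Ψ` move the identity by at most `ε`, and `Φ` contracts the
complement of the identity by about `1 - λ` in the normalized trace norm. Operator Sinkhorn scaling,
started at the identity, then contracts in this norm by a constant power of `exp (-λ)` per step, as
long as the iterates stay within a small multiple of `λ` of the identity in operator norm. The
first `log m / λ` steps stay there because each of them moves by `O(ε)` and `ε log m ≪ λ²`; after
them the contraction has absorbed the factor `√m` between the two norms. The limit solves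
`Φ X = Y⁻¹`, `Ψ Y = X⁻¹` with `X` and `Y` near the identity.

Scaling by such a pair makes the map doubly stochastic, so by Jensen's inequality for the logarithm
the capacity is `s · exp (-ψ)` with `ψ = log (det X) / n + log (det Y) / m`. In the second-order
expansion of `log det` at the identity, the first-order term is controlled by the imbalance and the
quadratic form is negative because of the gap, which leaves `ψ = O(ε² / λ)`.
-/

namespace OperatorScaling

open scoped MatrixOrder

section Loewner

theorem trace_le_trace {ι : Type*} [Fintype ι] {P Q : Matrix ι ι ℝ} (h : P ≤ Q) :
    P.trace ≤ Q.trace := by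
  simpa only [Matrix.trace_sub, sub_nonneg] using Matrix.PosSemidef.trace_nonneg h

theorem map_le_map {ι κ : Type*} {Φ : Matrix κ κ ℝ →ₗ[ℝ] Matrix ι ι ℝ} (hΦ : ∀ X, 0 ≤ X → 0 ≤ Φ X)
    {X X' : Matrix κ κ ℝ} (h : X ≤ X') : Φ X ≤ Φ X' := by
  simpa only [map_sub, sub_nonneg] using hΦ _ (sub_nonneg.2 h)

theorem smul_le_smul_left_of_nonneg {ι : Type*} {P Q : Matrix ι ι ℝ} {c : ℝ} (hc : 0 ≤ c)
    (h : P ≤ Q) : c • P ≤ c • Q := by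
  rw [← sub_nonneg, ← smul_sub]
  exact (Matrix.PosSemidef.smul h hc).nonneg

theorem smul_one_le_smul_one {ι : Type*} [DecidableEq ι] {a b : ℝ} (h : a ≤ b) :
    a • (1 : Matrix ι ι ℝ) ≤ b • 1 := by
  rw [← sub_nonneg, ← sub_smul]
  exact (Matrix.PosSemidef.one.smul (sub_nonneg.2 h)).nonneg

theorem posDef_of_smul_one_le {ι : Type*} [DecidableEq ι] {P : Matrix ι ι ℝ} {a : ℝ} (ha : 0 < a)
    (h : a • 1 ≤ P) : P.PosDef := by
  rw [← add_sub_cancel (a • 1) P]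
  exact (Matrix.PosDef.one.smul ha).add_posSemidef h

theorem isHermitian_of_le_smul_one {ι : Type*} [DecidableEq ι] {P : Matrix ι ι ℝ} {b : ℝ}
    (h : P ≤ b • 1) : P.IsHermitian := by
  rw [← sub_sub_cancel (b • 1) P]
  exact (Matrix.isHermitian_one.smul (star_trivial b)).sub (Matrix.PosSemidef.isHermitian h)

variable {ι : Type*} [Fintype ι] [DecidableEq ι] {P : Matrix ι ι ℝ} {a b c : ℝ}

theorem commute_inv_self (hP : P.PosDef) : Commute P⁻¹ P :=
  have hu := hP.det_pos.ne'.isUnit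
  (P.nonsing_inv_mul hu).trans (P.mul_nonsing_inv hu).symm

theorem inv_le_of_smul_one_le (ha : 0 < a) (h : a • 1 ≤ P) : P⁻¹ ≤ a⁻¹ • 1 := by
  have hP := posDef_of_smul_one_le ha h
  have factor : a⁻¹ • 1 - P⁻¹ = a⁻¹ • (P⁻¹ * (P - a • 1)) := by
    rw [mul_sub, P.nonsing_inv_mul hP.det_pos.ne'.isUnit, mul_smul_comm, mul_one, smul_sub,
      inv_smul_smul₀ ha.ne']
  have comm : Commute P⁻¹ (P - a • 1) :=
    (commute_inv_self hP).sub_right ((Commute.one_right _).smul_right a)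
  rw [← sub_nonneg, factor]
  exact smul_nonneg (inv_nonneg.2 ha.le)
    (comm.mul_nonneg hP.inv.posSemidef.nonneg (sub_nonneg.2 h))

theorem smul_one_le_inv (hP : P.PosDef) (hb : 0 < b) (h : P ≤ b • 1) : b⁻¹ • 1 ≤ P⁻¹ := by
  have factor : P⁻¹ - b⁻¹ • 1 = b⁻¹ • (P⁻¹ * (b • 1 - P)) := by
    rw [mul_sub, P.nonsing_inv_mul hP.det_pos.ne'.isUnit, mul_smul_comm, mul_one, smul_sub,
      inv_smul_smul₀ hb.ne']
  have comm : Commute P⁻¹ (b • 1 - P) :=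
    ((Commute.one_right _).smul_right b).sub_right (commute_inv_self hP)
  rw [← sub_nonneg, factor]
  exact smul_nonneg (inv_nonneg.2 hb.le)
    (comm.mul_nonneg hP.inv.posSemidef.nonneg (sub_nonneg.2 h))

theorem mul_self_le_sq_smul_one (h1 : -(c • 1) ≤ P) (h2 : P ≤ c • 1) : P * P ≤ c ^ 2 • 1 := by
  have hc (R : Matrix ι ι ℝ) : Commute R (c • 1) := (Commute.one_right R).smul_right c
  have factor : c ^ 2 • 1 - P * P = (c • 1 - P) * (c • 1 + P) := by
    rw [← (hc P).symm.mul_self_sub_mul_self_eq', smul_mul_smul_comm, mul_one, sq]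
  have comm : Commute (c • 1 - P) (c • 1 + P) :=
    (hc _).add_right ((hc P).symm.sub_left (Commute.refl P))
  rw [← sub_nonneg, factor]
  exact comm.mul_nonneg (sub_nonneg.2 h2) (neg_le_iff_add_nonneg'.1 h1)

theorem le_smul_one_iff (hP : P.IsHermitian) : P ≤ c • 1 ↔ ∀ i, hP.eigenvalues i ≤ c := by
  rw [← Algebra.algebraMap_eq_smul_one,
    le_algebraMap_iff_spectrum_le (a := P) hP.isSelfAdjoint, hP.spectrum_real_eq_range_eigenvalues,
    Set.forall_mem_range]

theorem smul_one_le_iff (hP : P.IsHermitian) : c • 1 ≤ P ↔ ∀ i, c ≤ hP.eigenvalues i := by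
  rw [← Algebra.algebraMap_eq_smul_one,
    algebraMap_le_iff_le_spectrum (a := P) hP.isSelfAdjoint, hP.spectrum_real_eq_range_eigenvalues,
    Set.forall_mem_range]

theorem trace_cfc (hP : P.IsHermitian) (f : ℝ → ℝ) :
    (cfc f P).trace = ∑ i, f (hP.eigenvalues i) := by
  rw [hP.cfc_eq, Matrix.IsHermitian.cfc, Unitary.conjStarAlgAut_apply, Matrix.trace_mul_cycle,
    Unitary.coe_star_mul_self, one_mul, Matrix.trace_diagonal]
  rfl

theorem trace_sub_smul_one_mul_self (hP : P.IsHermitian) (c : ℝ) :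
    ((P - c • 1) * (P - c • 1)).trace = ∑ i, (hP.eigenvalues i - c) ^ 2 := by
  have hcfc : cfc (fun x : ℝ => (x - c) ^ 2) P = (P - c • 1) * (P - c • 1) := by
    rw [cfc_pow (fun x : ℝ => x - c) 2 P, cfc_sub (fun x : ℝ => x) (fun _ => c) P, cfc_id' ℝ P,
      cfc_const c P, Algebra.algebraMap_eq_smul_one, sq]
  rw [← hcfc, trace_cfc hP]

theorem log_det_eq_sum_log_eigenvalues (hP : P.PosDef) :
    Real.log P.det = ∑ i, Real.log (hP.isHermitian.eigenvalues i) := by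
  rw [hP.isHermitian.det_eq_prod_eigenvalues, ← Real.log_prod fun i _ => (hP.eigenvalues_pos i).ne']
  rfl

theorem log_det_eq_trace_cfc_log (hP : P.PosDef) :
    Real.log P.det = (cfc Real.log P).trace := by
  rw [trace_cfc hP.isHermitian, log_det_eq_sum_log_eigenvalues hP]

theorem exists_eq_star_mul_self (hP : P.PosDef) : ∃ S : Matrix ι ι ℝ, IsUnit S ∧ P = star S * S :=
  CStarAlgebra.isStrictlyPositive_iff_eq_star_mul_self.1 hP.isStrictlyPositive

theorem exists_smul_one_le {ι : Type*} [Finite ι] [DecidableEq ι] {P : Matrix ι ι ℝ}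
    (hP : P.PosDef) : ∃ a : ℝ, 0 < a ∧ a • 1 ≤ P := by
  have := Fintype.ofFinite ι
  rcases isEmpty_or_nonempty ι with _ | _
  · exact ⟨1, one_pos, (Subsingleton.elim _ P).le⟩
  · obtain ⟨j, hj⟩ := Finite.exists_min hP.isHermitian.eigenvalues
    exact ⟨_, hP.eigenvalues_pos j, (smul_one_le_iff hP.isHermitian).2 hj⟩

theorem cfc_log_le (hP : P.PosDef) (hc : 0 < c) :
    cfc Real.log P ≤ c⁻¹ • P + (Real.log c - 1) • 1 := by
  have tangent : cfc (fun x => c⁻¹ * x + (Real.log c - 1)) P = c⁻¹ • P + (Real.log c - 1) • 1 := by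
    rw [cfc_add_const (Real.log c - 1) (fun x => c⁻¹ * x) P, cfc_const_mul_id c⁻¹ P,
      Algebra.algebraMap_eq_smul_one]
  rw [← tangent]
  refine cfc_mono (fun x hx => ?_) ((Matrix.finite_real_spectrum (A := P)).continuousOn _)
    (by fun_prop)
  obtain ⟨i, rfl⟩ := hP.isHermitian.spectrum_real_eq_range_eigenvalues ▸ hx
  have hx0 := hP.eigenvalues_pos i
  have := Real.log_le_sub_one_of_pos (mul_pos (inv_pos.2 hc) hx0)
  rw [Real.log_mul (inv_pos.2 hc).ne' hx0.ne', Real.log_inv] at this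
  linarith

theorem trace_le_log_det {M : Matrix ι ι ℝ} (hP : P.PosDef)
    (h : ∀ c : ℝ, 0 < c → M ≤ c⁻¹ • P + (Real.log c - 1) • 1) : M.trace ≤ Real.log P.det := by
  set U : Matrix ι ι ℝ := hP.isHermitian.eigenvectorUnitary.1
  set w := hP.isHermitian.eigenvalues
  have hU : star U * U = 1 := Unitary.coe_star_mul_self _
  have hU' : U * star U = 1 := Unitary.coe_mul_star_self _
  have hdiag : star U * P * U = Matrix.diagonal w := by
    simpa [Unitary.conjStarAlgAut_apply] using
      hP.isHermitian.conjStarAlgAut_star_eigenvectorUnitary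
  have hentry (a : ι) : (star U * M * U) a a ≤ Real.log (w a) := by
    have hconj := star_left_conjugate_le_conjugate (h _ (hP.eigenvalues_pos a)) U
    have := Matrix.PosSemidef.diag_nonneg (i := a) hconj
    rw [mul_add, add_mul, mul_smul_comm, smul_mul_assoc, hdiag, mul_smul_comm, mul_one,
      smul_mul_assoc, hU] at this
    simp only [Matrix.sub_apply, Matrix.add_apply, Matrix.smul_apply, Matrix.diagonal_apply_eq,
      Matrix.one_apply_eq, smul_eq_mul, mul_one, w,
      inv_mul_cancel₀ (hP.eigenvalues_pos a).ne'] at this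
    linarith
  calc M.trace = (star U * M * U).trace := by rw [Matrix.trace_mul_cycle, hU', one_mul]
    _ ≤ Real.log P.det := by
        rw [log_det_eq_sum_log_eigenvalues hP]
        exact Finset.sum_le_sum fun a _ => hentry a

theorem posDef_map {ι κ : Type*} [Finite ι] [DecidableEq ι] [DecidableEq κ]
    {Φ : Matrix ι ι ℝ →ₗ[ℝ] Matrix κ κ ℝ} (hΦ : ∀ X, 0 ≤ X → 0 ≤ Φ X) (hΦ1 : Φ 1 = 1)
    {P : Matrix ι ι ℝ} (hP : P.PosDef) : (Φ P).PosDef := by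
  obtain ⟨a, ha, haP⟩ := exists_smul_one_le hP
  refine posDef_of_smul_one_le ha ?_
  simpa only [map_smul, hΦ1] using map_le_map hΦ haP

-- Jensen's inequality for the logarithm, through the tangent lines of the latter.
theorem log_det_div_le_log_det_map_div {κ : Type*} [Fintype κ] [DecidableEq κ]
    {Φ : Matrix ι ι ℝ →ₗ[ℝ] Matrix κ κ ℝ} (hΦ : ∀ X, 0 ≤ X → 0 ≤ Φ X) (hΦ1 : Φ 1 = 1)
    (htrace : ∀ X, (Φ X).trace / Fintype.card κ = X.trace / Fintype.card ι) (hP : P.PosDef) :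
    Real.log P.det / Fintype.card ι ≤ Real.log (Φ P).det / Fintype.card κ := by
  rw [log_det_eq_trace_cfc_log hP, ← htrace]
  refine div_le_div_of_nonneg_right (trace_le_log_det (posDef_map hΦ hΦ1 hP) fun c hc => ?_)
    (Nat.cast_nonneg _)
  simpa only [map_add, map_smul, hΦ1] using map_le_map hΦ (cfc_log_le hP hc)

theorem det_rpow_inv_card_le_trace_div [Nonempty ι] (hP : P.PosSemidef) :
    P.det ^ (1 / (Fintype.card ι : ℝ)) ≤ P.trace / Fintype.card ι := by
  have amgm := Real.geom_mean_le_arith_mean Finset.univ (fun _ : ι => (1 : ℝ)) hP.1.eigenvalues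
    (fun _ _ => zero_le_one) (by simp [Fintype.card_pos]) (fun i _ => hP.eigenvalues_nonneg i)
  rw [hP.1.det_eq_prod_eigenvalues, hP.1.trace_eq_sum_eigenvalues]
  simpa using amgm

end Loewner

section NormalizedTrace

theorem posDef_inv_card_smul_one {ι : Type*} [Fintype ι] [DecidableEq ι] :
    ((Fintype.card ι : ℝ)⁻¹ • (1 : Matrix ι ι ℝ)).PosDef := by
  rcases isEmpty_or_nonempty ι with _ | _
  · rw [Subsingleton.elim ((Fintype.card ι : ℝ)⁻¹ • (1 : Matrix ι ι ℝ)) 1]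
    exact Matrix.PosDef.one
  · exact Matrix.PosDef.one.smul (inv_pos.2 (Nat.cast_pos.2 Fintype.card_pos))

/-- The Frobenius norm divided by the square root of the dimension, for which the identity matrix
has norm one. -/
noncomputable abbrev normalizedTraceNorm {ι : Type*} [Fintype ι] [DecidableEq ι] :
    NormedAddCommGroup (Matrix ι ι ℝ) :=
  Matrix.toMatrixNormedAddCommGroup _ posDef_inv_card_smul_one

attribute [local instance] normalizedTraceNorm

/-- The inner product `tr(Xᵀ Y) / d` on `d × d` matrices; it is a local instance below. -/
noncomputable abbrev normalizedTraceInner {ι : Type*} [Fintype ι] [DecidableEq ι] :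
    InnerProductSpace ℝ (Matrix ι ι ℝ) :=
  Matrix.toMatrixInnerProductSpace _ posDef_inv_card_smul_one.posSemidef

/-- The uniformity of the normalized trace norm. It has to be preferred explicitly over the product
uniformity which Mathlib puts on matrices: the two are equal, but not definitionally. -/
noncomputable abbrev normalizedTraceUniformSpace {ι : Type*} [Fintype ι] [DecidableEq ι] :
    UniformSpace (Matrix ι ι ℝ) :=
  normalizedTraceNorm.toMetricSpace.toUniformSpace

/-- The topology of the normalized trace norm; see `normalizedTraceUniformSpace`. -/
noncomputable abbrev normalizedTraceTopology {ι : Type*} [Fintype ι] [DecidableEq ι] :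
    TopologicalSpace (Matrix ι ι ℝ) :=
  normalizedTraceUniformSpace.toTopologicalSpace

end NormalizedTrace

attribute [local instance] normalizedTraceNorm normalizedTraceInner normalizedTraceUniformSpace
  normalizedTraceTopology

open scoped RealInnerProductSpace

section NormalizedTrace

variable {ι : Type*} [Fintype ι] [DecidableEq ι] {P Q X : Matrix ι ι ℝ} {b c δ : ℝ}

theorem inner_eq_trace (X Y : Matrix ι ι ℝ) : ⟪X, Y⟫ = (Xᵀ * Y).trace / Fintype.card ι := by
  change (Y * ((Fintype.card ι : ℝ)⁻¹ • (1 : Matrix ι ι ℝ)) * Xᴴ).trace = _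
  rw [mul_smul_comm, mul_one, smul_mul_assoc, Matrix.trace_smul, Matrix.trace_mul_comm,
    Matrix.conjTranspose_eq_transpose_of_trivial, smul_eq_mul, inv_mul_eq_div]

theorem inner_one_left_eq_trace (X : Matrix ι ι ℝ) : ⟪1, X⟫ = X.trace / Fintype.card ι := by
  rw [inner_eq_trace, Matrix.transpose_one, one_mul]

theorem norm_sq_eq_trace (X : Matrix ι ι ℝ) : ‖X‖ ^ 2 = (Xᵀ * X).trace / Fintype.card ι := by
  rw [← real_inner_self_eq_norm_sq, inner_eq_trace]

theorem norm_sq_eq_trace_of_isHermitian (hX : X.IsHermitian) :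
    ‖X‖ ^ 2 = (X * X).trace / Fintype.card ι := by
  rw [norm_sq_eq_trace, ← Matrix.conjTranspose_eq_transpose_of_trivial, hX.eq]

theorem norm_transpose (X : Matrix ι ι ℝ) : ‖Xᵀ‖ = ‖X‖ := by
  rw [← sq_eq_sq₀ (norm_nonneg _) (norm_nonneg _), norm_sq_eq_trace, norm_sq_eq_trace,
    Matrix.transpose_transpose, Matrix.trace_mul_comm]

theorem norm_one_eq_one [Nonempty ι] : ‖(1 : Matrix ι ι ℝ)‖ = 1 := by
  rw [← sq_eq_sq₀ (norm_nonneg _) zero_le_one, norm_sq_eq_trace]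
  simp

theorem inner_one_left_mono (h : P ≤ Q) : ⟪1, P⟫ ≤ ⟪1, Q⟫ := by
  rw [inner_one_left_eq_trace, inner_one_left_eq_trace]
  exact div_le_div_of_nonneg_right (trace_le_trace h) (Nat.cast_nonneg _)

theorem inner_one_left_smul_one [Nonempty ι] : ⟪(1 : Matrix ι ι ℝ), c • 1⟫ = c := by
  rw [real_inner_smul_right, real_inner_self_eq_norm_sq, norm_one_eq_one, one_pow, mul_one]

theorem transpose_eq_of_isHermitian {ι : Type*} {P : Matrix ι ι ℝ} (hP : P.IsHermitian) :
    Pᵀ = P :=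
  (Matrix.conjTranspose_eq_transpose_of_trivial P).symm.trans hP.eq

theorem inner_inv_left_eq_one [Nonempty ι] (hP : P.PosDef) : ⟪P⁻¹, P⟫ = 1 := by
  rw [inner_eq_trace, transpose_eq_of_isHermitian hP.isHermitian.inv,
    P.nonsing_inv_mul hP.det_pos.ne'.isUnit]
  simp

theorem inner_inv_right_eq_one [Nonempty ι] (hP : P.PosDef) : ⟪P, P⁻¹⟫ = 1 :=
  (real_inner_comm _ _).trans (inner_inv_left_eq_one hP)

theorem norm_mul_le_of_le (hc : 0 ≤ c) (h1 : -(c • 1) ≤ P) (h2 : P ≤ c • 1) (X : Matrix ι ι ℝ) :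
    ‖P * X‖ ≤ c * ‖X‖ := by
  have gram : (P * X)ᵀ * (P * X) = Xᵀ * (P * P) * X := by
    rw [Matrix.transpose_mul, transpose_eq_of_isHermitian (isHermitian_of_le_smul_one h2)]
    simp only [mul_assoc]
  have conj : Xᵀ * (P * P) * X ≤ c ^ 2 • (Xᵀ * X) := by
    have := star_left_conjugate_le_conjugate (mul_self_le_sq_smul_one h1 h2) X
    rwa [mul_smul_comm, mul_one, smul_mul_assoc, Matrix.star_eq_conjTranspose,
      Matrix.conjTranspose_eq_transpose_of_trivial] at this
  have htrace := trace_le_trace conj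
  rw [Matrix.trace_smul, smul_eq_mul, ← gram] at htrace
  rw [← sq_le_sq₀ (norm_nonneg _) (mul_nonneg hc (norm_nonneg _)), mul_pow, norm_sq_eq_trace,
    norm_sq_eq_trace, mul_div]
  gcongr

theorem norm_mul_le_of_le' (hc : 0 ≤ c) (h1 : -(c • 1) ≤ P) (h2 : P ≤ c • 1) (X : Matrix ι ι ℝ) :
    ‖X * P‖ ≤ c * ‖X‖ := by
  rw [← norm_transpose, Matrix.transpose_mul, ← norm_transpose X,
    transpose_eq_of_isHermitian (isHermitian_of_le_smul_one h2)]
  exact norm_mul_le_of_le hc h1 h2 _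

theorem norm_le_of_le [Nonempty ι] (hc : 0 ≤ c) (h1 : -(c • 1) ≤ P) (h2 : P ≤ c • 1) :
    ‖P‖ ≤ c := by
  simpa only [mul_one, norm_one_eq_one] using norm_mul_le_of_le hc h1 h2 1

theorem norm_sub_one_le_of_le [Nonempty ι] (hc : 0 ≤ c) (h1 : (1 - c) • 1 ≤ P)
    (h2 : P ≤ (1 + c) • 1) : ‖P - 1‖ ≤ c := by
  rw [sub_smul, one_smul, sub_eq_add_neg, ← le_sub_iff_add_le'] at h1
  rw [add_smul, one_smul, ← sub_le_iff_le_add'] at h2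
  exact norm_le_of_le hc h1 h2

theorem abs_eigenvalues_le (hX : X.IsHermitian) (i : ι) :
    |hX.eigenvalues i| ≤ √(Fintype.card ι) * ‖X‖ := by
  have : Nonempty ι := ⟨i⟩
  have hsum : ∑ j, hX.eigenvalues j ^ 2 = Fintype.card ι * ‖X‖ ^ 2 := by
    have := trace_sub_smul_one_mul_self hX 0
    simp only [zero_smul, sub_zero] at this
    rw [norm_sq_eq_trace_of_isHermitian hX, mul_div_cancel₀ _ (by positivity), this]
  refine abs_le_of_sq_le_sq ?_ (by positivity)
  rw [mul_pow, Real.sq_sqrt (Nat.cast_nonneg _), ← hsum]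
  exact Finset.single_le_sum (f := fun j => hX.eigenvalues j ^ 2) (fun j _ => sq_nonneg _)
    (Finset.mem_univ i)

theorem le_norm_smul_one (hX : X.IsHermitian) : X ≤ (√(Fintype.card ι) * ‖X‖) • 1 :=
  (le_smul_one_iff hX).2 fun i => (le_abs_self _).trans (abs_eigenvalues_le hX i)

theorem neg_norm_smul_one_le (hX : X.IsHermitian) : -((√(Fintype.card ι) * ‖X‖) • 1) ≤ X := by
  rw [← neg_smul, smul_one_le_iff hX]
  exact fun i => (abs_le.1 (abs_eigenvalues_le hX i)).1

theorem isClosed_setOf_nonneg : IsClosed {X : Matrix ι ι ℝ | 0 ≤ X} := by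
  have hcont (f : Matrix ι ι ℝ →ₗ[ℝ] ℝ) : Continuous f := f.continuous_of_finiteDimensional
  simp only [Matrix.nonneg_iff_posSemidef, Matrix.posSemidef_iff_dotProduct_mulVec,
    Matrix.IsHermitian.ext_iff, star_trivial, Set.ofPred_and, Set.ofPred_forall]
  refine (isClosed_iInter fun i => isClosed_iInter fun j => isClosed_eq
    (hcont (Matrix.entryLinearMap ℝ ℝ j i)) (hcont (Matrix.entryLinearMap ℝ ℝ i j))).inter
    (isClosed_iInter fun x => isClosed_le continuous_const ?_)
  exact hcont (dotProductBilin ℝ ℝ x ∘ₗ (Matrix.mulVecBilin ℝ ℝ).flip x)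

theorem norm_inv_sub_inv_le (hc : 0 ≤ c) (hP : P.PosDef) (hQ : Q.PosDef) (hP' : P⁻¹ ≤ c • 1)
    (hQ' : Q⁻¹ ≤ c • 1) : ‖P⁻¹ - Q⁻¹‖ ≤ c ^ 2 * ‖P - Q‖ := by
  have neg_le {R : Matrix ι ι ℝ} (hR : R.PosDef) : -(c • 1) ≤ R⁻¹ :=
    (neg_nonpos.2 (smul_nonneg hc zero_le_one)).trans hR.inv.posSemidef.nonneg
  have resolvent : P⁻¹ - Q⁻¹ = P⁻¹ * ((Q - P) * Q⁻¹) := by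
    rw [sub_mul, mul_sub, Q.mul_nonsing_inv hQ.det_pos.ne'.isUnit, mul_one, ← mul_assoc,
      P.nonsing_inv_mul hP.det_pos.ne'.isUnit, one_mul]
  calc ‖P⁻¹ - Q⁻¹‖ ≤ c * ‖(Q - P) * Q⁻¹‖ := resolvent ▸ norm_mul_le_of_le hc (neg_le hP) hP' _
    _ ≤ c * (c * ‖Q - P‖) := by gcongr; exact norm_mul_le_of_le' hc (neg_le hQ) hQ' _
    _ = c ^ 2 * ‖P - Q‖ := by rw [norm_sub_rev, sq, mul_assoc]

theorem abs_log_sub_quadratic_le {y : ℝ} (hδ : δ ≤ 1 / 2) (hy : |y - 1| ≤ δ) :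
    |Real.log y - ((y - 1) - (y - 1) ^ 2 / 2)| ≤ 2 * δ * (y - 1) ^ 2 := by
  have taylor := Real.abs_log_sub_add_sum_range_le (x := 1 - y) (by rw [abs_sub_comm]; linarith) 2
  rw [sub_sub_cancel, abs_sub_comm 1 y] at taylor
  calc |Real.log y - ((y - 1) - (y - 1) ^ 2 / 2)| ≤ |y - 1| ^ 3 / (1 - |y - 1|) := by
        convert taylor using 2
        norm_num [Finset.sum_range_succ]
        ring
    _ ≤ |y - 1| ^ 3 / (1 / 2) := by gcongr; linarith
    _ = 2 * |y - 1| * (y - 1) ^ 2 := by rw [← sq_abs (y - 1)]; ring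
    _ ≤ 2 * δ * (y - 1) ^ 2 := by gcongr

theorem abs_log_det_sub_quadratic_le (hδ : δ ≤ 1 / 2) (h1 : (1 - δ) • 1 ≤ P)
    (h2 : P ≤ (1 + δ) • 1) :
    |Real.log P.det / Fintype.card ι - (⟪1, P - 1⟫ - ‖P - 1‖ ^ 2 / 2)| ≤
      2 * δ * ‖P - 1‖ ^ 2 := by
  have hP : P.PosDef := posDef_of_smul_one_le (by linarith) h1
  set μ := hP.isHermitian.eigenvalues
  have hμ (i : ι) : |μ i - 1| ≤ δ := by
    rw [abs_le]
    constructor <;> linarith [(smul_one_le_iff hP.isHermitian).1 h1 i,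
      (le_smul_one_iff hP.isHermitian).1 h2 i]
  have hlin : (P - 1).trace = ∑ i, (μ i - 1) := by
    rw [Matrix.trace_sub, hP.isHermitian.trace_eq_sum_eigenvalues]
    simp [μ]
  have hquad : ((P - 1) * (P - 1)).trace = ∑ i, (μ i - 1) ^ 2 := by
    simpa only [one_smul] using trace_sub_smul_one_mul_self hP.isHermitian 1
  rw [inner_one_left_eq_trace, norm_sq_eq_trace_of_isHermitian
    (hP.isHermitian.sub Matrix.isHermitian_one), hlin, hquad, div_right_comm, ← sub_div, ← sub_div,
    abs_div, Nat.abs_cast, mul_div, log_det_eq_sum_log_eigenvalues hP, Finset.sum_div,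
    ← Finset.sum_sub_distrib, ← Finset.sum_sub_distrib, Finset.mul_sum]
  gcongr
  exact (Finset.abs_sum_le_sum_abs _ _).trans
    (Finset.sum_le_sum fun i _ => abs_log_sub_quadratic_le hδ (hμ i))

end NormalizedTrace

section LogNear

theorem exp_neg_le_one_sub_half {x : ℝ} (hx0 : 0 ≤ x) (hx1 : x ≤ 1) :
    Real.exp (-x) ≤ 1 - x / 2 := by
  rw [Real.exp_neg]
  refine inv_le_of_inv_le₀ (by linarith) (le_trans ?_ (Real.add_one_le_exp _))
  rw [inv_le_iff_one_le_mul₀ (by linarith)]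
  nlinarith

/-- `X` is within distance `t` of the identity in Thompson's metric on the positive definite
cone. -/
structure LogNear {ι : Type*} [DecidableEq ι] (t : ℝ) (X : Matrix ι ι ℝ) : Prop where
  lower : Real.exp (-t) • 1 ≤ X
  upper : X ≤ Real.exp t • 1

namespace LogNear

variable {ι : Type*} [DecidableEq ι] {X D : Matrix ι ι ℝ} {t t' c η : ℝ}

theorem posDef (h : LogNear t X) : X.PosDef :=
  posDef_of_smul_one_le (Real.exp_pos _) h.lower

theorem zero_one : LogNear 0 (1 : Matrix ι ι ℝ) := by
  constructor <;> simp

theorem mono (h : LogNear t X) (htt' : t ≤ t') : LogNear t' X where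
  lower := (smul_one_le_smul_one (by gcongr)).trans h.lower
  upper := h.upper.trans (smul_one_le_smul_one (by gcongr))

theorem smul (h : LogNear t X) (hc : 0 < c) : LogNear (t + |Real.log c|) (c • X) := by
  have hexp (r : ℝ) : c * Real.exp r = Real.exp (r + Real.log c) := by
    rw [Real.exp_add, Real.exp_log hc, mul_comm]
  constructor
  · refine (smul_one_le_smul_one ?_).trans
      ((smul_smul c _ _).ge.trans (smul_le_smul_left_of_nonneg hc.le h.lower))
    rw [hexp]
    gcongr
    linarith [neg_abs_le (Real.log c)]
  · refine ((smul_le_smul_left_of_nonneg hc.le h.upper).trans (smul_smul c _ _).le).trans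
      (smul_one_le_smul_one ?_)
    rw [hexp]
    gcongr
    exact le_abs_self _

theorem nonneg [Nonempty ι] (h : LogNear t X) : 0 ≤ t := by
  have i := Classical.arbitrary ι
  have hdiag := Matrix.PosSemidef.diag_nonneg (i := i) (h.lower.trans h.upper)
  rw [Matrix.sub_apply, Matrix.smul_apply, Matrix.smul_apply, Matrix.one_apply_eq, smul_eq_mul,
    smul_eq_mul, mul_one, mul_one, sub_nonneg, Real.exp_le_exp] at hdiag
  linarith

theorem one_sub_smul_one_le [Nonempty ι] (h : LogNear t X) : (1 - 2 * t) • 1 ≤ X := by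
  refine (smul_one_le_smul_one ?_).trans h.lower
  linarith [Real.add_one_le_exp (-t), h.nonneg]

theorem le_one_add_smul_one [Nonempty ι] (h : LogNear t X) (ht : t ≤ 1) :
    X ≤ (1 + 2 * t) • 1 := by
  refine h.upper.trans (smul_one_le_smul_one ?_)
  have := Real.abs_exp_sub_one_le (x := t) (by rwa [abs_of_nonneg h.nonneg])
  rw [abs_of_nonneg h.nonneg] at this
  linarith [le_abs_self (Real.exp t - 1)]

variable [Fintype ι]

theorem inv (h : LogNear t X) : LogNear t X⁻¹ where
  lower := by
    simpa only [Real.exp_neg] using smul_one_le_inv h.posDef (Real.exp_pos t) h.upper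
  upper := by
    simpa only [Real.exp_neg, inv_inv] using inv_le_of_smul_one_le (Real.exp_pos (-t)) h.lower

theorem exp_neg_le_inner_one [Nonempty ι] (h : LogNear t X) : Real.exp (-t) ≤ ⟪1, X⟫ :=
  inner_one_left_smul_one.symm.trans_le (inner_one_left_mono h.lower)

theorem inner_one_le_exp [Nonempty ι] (h : LogNear t X) : ⟪1, X⟫ ≤ Real.exp t :=
  (inner_one_left_mono h.upper).trans_eq inner_one_left_smul_one

theorem inner_one_pos [Nonempty ι] (h : LogNear t X) : 0 < ⟪1, X⟫ :=
  (Real.exp_pos _).trans_le h.exp_neg_le_inner_one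

theorem abs_log_inner_one_le [Nonempty ι] (h : LogNear t X) : |Real.log ⟪1, X⟫| ≤ t :=
  abs_le.2 ⟨(Real.le_log_iff_exp_le h.inner_one_pos).2 h.exp_neg_le_inner_one,
    (Real.log_le_iff_le_exp h.inner_one_pos).2 h.inner_one_le_exp⟩

theorem norm_sub_one_le [Nonempty ι] (h : LogNear t X) (ht : t ≤ 1) : ‖X - 1‖ ≤ 2 * t :=
  norm_sub_one_le_of_le (by linarith [h.nonneg]) h.one_sub_smul_one_le (h.le_one_add_smul_one ht)

theorem add [Nonempty ι] (h : LogNear t X) (ht : t ≤ 1 / 2) (hD : D.IsHermitian)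
    (hDη : √(Fintype.card ι) * ‖D‖ ≤ η) (hη : η ≤ 1 / 4) : LogNear (t + 4 * η) (X + D) := by
  have hη0 : 0 ≤ η := le_trans (by positivity) hDη
  constructor
  · have hD' : -(η • 1) ≤ D := (neg_le_neg (by gcongr)).trans (neg_norm_smul_one_le hD)
    refine le_trans ?_ (add_le_add h.lower hD')
    rw [← neg_smul, ← add_smul]
    refine smul_le_smul_of_nonneg_right ?_ zero_le_one
    have hexp : 1 / 2 ≤ Real.exp (-t) := by linarith [Real.add_one_le_exp (-t)]
    calc Real.exp (-(t + 4 * η)) = Real.exp (-t) * Real.exp (-(4 * η)) := by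
          rw [← Real.exp_add]; ring_nf
      _ ≤ Real.exp (-t) * (1 - 4 * η / 2) := by
          gcongr
          exact exp_neg_le_one_sub_half (by linarith) (by linarith)
      _ ≤ Real.exp (-t) + -η := by nlinarith
  · have hD' : D ≤ η • 1 := (le_norm_smul_one hD).trans (by gcongr)
    refine (add_le_add h.upper hD').trans ?_
    rw [← add_smul]
    refine smul_le_smul_of_nonneg_right ?_ zero_le_one
    calc Real.exp t + η ≤ Real.exp t * (1 + 4 * η) := by
          nlinarith [Real.one_le_exp h.nonneg]
      _ ≤ Real.exp t * Real.exp (4 * η) := by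
          gcongr
          linarith [Real.add_one_le_exp (4 * η)]
      _ = Real.exp (t + 4 * η) := (Real.exp_add _ _).symm

theorem isClosed_setOf (t : ℝ) : IsClosed {X : Matrix ι ι ℝ | LogNear t X} := by
  have hset : {X : Matrix ι ι ℝ | LogNear t X} =
      (fun X => X - Real.exp (-t) • 1) ⁻¹' {X | 0 ≤ X} ∩
        (fun X => Real.exp t • 1 - X) ⁻¹' {X | 0 ≤ X} := by
    ext X
    simp only [Set.mem_inter_iff, Set.mem_preimage, Set.mem_ofPred_eq, sub_nonneg]
    exact ⟨fun h => ⟨h.lower, h.upper⟩, fun h => ⟨h.1, h.2⟩⟩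
  rw [hset]
  exact (isClosed_setOf_nonneg.preimage (by fun_prop)).inter
    (isClosed_setOf_nonneg.preimage (by fun_prop))

end LogNear

end LogNear

section NearlyUnital

/-- A positive map which moves the identity by at most `ε`. -/
structure IsNearlyUnital {ι κ : Type*} [DecidableEq ι] [DecidableEq κ]
    (Φ : Matrix κ κ ℝ →ₗ[ℝ] Matrix ι ι ℝ) (ε : ℝ) : Prop where
  map_nonneg : ∀ X, 0 ≤ X → 0 ≤ Φ X
  lower : (1 - ε) • 1 ≤ Φ 1
  upper : Φ 1 ≤ (1 + ε) • 1

variable {ι κ : Type*} [DecidableEq ι] [DecidableEq κ]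
  {Φ : Matrix κ κ ℝ →ₗ[ℝ] Matrix ι ι ℝ} {ε a b t : ℝ} {X : Matrix κ κ ℝ}

namespace IsNearlyUnital

theorem smul_one_le_map (h : IsNearlyUnital Φ ε) (ha : 0 ≤ a) (hX : a • 1 ≤ X) :
    (a * (1 - ε)) • 1 ≤ Φ X := by
  refine le_trans ?_ (map_le_map h.map_nonneg hX)
  rw [map_smul, mul_smul]
  exact smul_le_smul_left_of_nonneg ha h.lower

theorem map_le_smul_one (h : IsNearlyUnital Φ ε) (hb : 0 ≤ b) (hX : X ≤ b • 1) :
    Φ X ≤ (b * (1 + ε)) • 1 := by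
  refine (map_le_map h.map_nonneg hX).trans ?_
  rw [map_smul, mul_smul]
  exact smul_le_smul_left_of_nonneg hb h.upper

theorem logNear_map (h : IsNearlyUnital Φ ε) (hε0 : 0 ≤ ε) (hε : ε ≤ 1 / 2) (hX : LogNear t X) :
    LogNear (t + 2 * ε) (Φ X) where
  lower := by
    refine le_trans ?_ (h.smul_one_le_map (Real.exp_pos _).le hX.lower)
    have : Real.exp (-(2 * ε)) ≤ 1 - ε := by
      linarith [exp_neg_le_one_sub_half (x := 2 * ε) (by linarith) (by linarith)]
    rw [neg_add, Real.exp_add]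
    exact smul_one_le_smul_one (by gcongr)
  upper := by
    refine (h.map_le_smul_one (Real.exp_pos _).le hX.upper).trans ?_
    rw [Real.exp_add]
    refine smul_one_le_smul_one ?_
    gcongr
    linarith [Real.add_one_le_exp (2 * ε)]

variable [Fintype ι]

theorem norm_map_one_sub_one_le [Nonempty ι] (h : IsNearlyUnital Φ ε) (hε : 0 ≤ ε) :
    ‖Φ 1 - 1‖ ≤ ε :=
  norm_sub_one_le_of_le hε h.lower h.upper

theorem norm_inv_map_sub_inv_map_le (h : IsNearlyUnital Φ ε) (hε0 : 0 ≤ ε)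
    (hε : ε ≤ 1 / 2) {X X' : Matrix κ κ ℝ} (hX : LogNear t X) (hX' : LogNear t X') :
    ‖(Φ X)⁻¹ - (Φ X')⁻¹‖ ≤ Real.exp (2 * (t + 2 * ε)) * ‖Φ (X - X')‖ := by
  have hΦX := h.logNear_map hε0 hε hX
  have hΦX' := h.logNear_map hε0 hε hX'
  have := norm_inv_sub_inv_le (Real.exp_pos _).le hΦX.posDef hΦX'.posDef hΦX.inv.upper
    hΦX'.inv.upper
  rwa [← Real.exp_nat_mul, Nat.cast_ofNat, ← map_sub] at this

end IsNearlyUnital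

end NearlyUnital

section BalancedPair

/-- A pair of mutually adjoint, nearly unital maps of operator norm at most `1 + ε`. The field
`inner_one_map_one` fixes their scale: the diagonal entries of `Φ 1` have average one. -/
structure IsBalancedPair {ι κ : Type*} [Fintype ι] [Fintype κ] [DecidableEq ι] [DecidableEq κ]
    (Φ : Matrix κ κ ℝ →ₗ[ℝ] Matrix ι ι ℝ) (Ψ : Matrix ι ι ℝ →ₗ[ℝ] Matrix κ κ ℝ) (ε : ℝ) :
    Prop where
  eps_nonneg : 0 ≤ ε
  left : IsNearlyUnital Φ ε
  right : IsNearlyUnital Ψ ε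
  inner_map : ∀ (Y : Matrix ι ι ℝ) (X : Matrix κ κ ℝ), ⟪Y, Φ X⟫ = ⟪Ψ Y, X⟫
  inner_one_map_one : ⟪1, Φ 1⟫ = 1
  norm_map_le : ∀ X, ‖Φ X‖ ≤ (1 + ε) * ‖X‖

theorem norm_sq_map_le_of_gap {E F : Type*} [NormedAddCommGroup E] [InnerProductSpace ℝ E]
    [NormedAddCommGroup F] [InnerProductSpace ℝ F] {T : E →ₗ[ℝ] F} {p : E →ₗ[ℝ] ℝ} {q c : ℝ}
    {e d : E} (hq0 : 0 ≤ q) (hq1 : q < 1) (hp : ∀ w, p w = 0 → ‖T w‖ ≤ q * ‖w‖) (he : ‖e‖ = 1)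
    (hTe : 1 ≤ ‖T e‖) (hed : ⟪e, d⟫ = 0) (hc : |⟪T e, T d⟫| ≤ c * ‖d‖) :
    ‖T d‖ ^ 2 ≤ (q ^ 2 + c ^ 2 / (1 - q ^ 2)) * ‖d‖ ^ 2 := by
  have hpe : p e ≠ 0 := fun h => by linarith [hp e h, he ▸ hp e h]
  set s := p d / p e with hs
  have hkernel : p (d - s • e) = 0 := by
    rw [map_sub, map_smul, smul_eq_mul, hs, div_mul_cancel₀ _ hpe, sub_self]
  have hbound : ‖T d‖ ^ 2 - 2 * (s * ⟪T e, T d⟫) + s ^ 2 * ‖T e‖ ^ 2 ≤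
      q ^ 2 * (‖d‖ ^ 2 + s ^ 2) := by
    have := pow_le_pow_left₀ (norm_nonneg _) (hp _ hkernel) 2
    rw [mul_pow, map_sub, map_smul, norm_sub_sq_real, norm_sub_sq_real, real_inner_smul_right,
      real_inner_smul_right, real_inner_comm, real_inner_comm e, hed, norm_smul, norm_smul, he,
      mul_pow, mul_one, Real.norm_eq_abs, sq_abs] at this
    linarith
  have hcross : s * ⟪T e, T d⟫ ≤ |s| * (c * ‖d‖) := by
    refine (le_abs_self _).trans ?_
    rw [abs_mul]
    gcongr
  have hTe2 : s ^ 2 ≤ s ^ 2 * ‖T e‖ ^ 2 :=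
    le_mul_of_one_le_right (sq_nonneg s) (one_le_pow₀ hTe)
  have hq : 0 < 1 - q ^ 2 := by nlinarith
  have hsquare : 2 * (|s| * (c * ‖d‖)) - (1 - q ^ 2) * s ^ 2 ≤ (c * ‖d‖) ^ 2 / (1 - q ^ 2) := by
    rw [le_div_iff₀ hq, ← sq_abs s]
    nlinarith [sq_nonneg ((1 - q ^ 2) * |s| - c * ‖d‖)]
  calc ‖T d‖ ^ 2 ≤ q ^ 2 * ‖d‖ ^ 2 + (c * ‖d‖) ^ 2 / (1 - q ^ 2) := by linarith
    _ = (q ^ 2 + c ^ 2 / (1 - q ^ 2)) * ‖d‖ ^ 2 := by ring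

variable {ι κ : Type*} [Fintype ι] [Fintype κ] [DecidableEq ι] [DecidableEq κ]
  {Φ : Matrix κ κ ℝ →ₗ[ℝ] Matrix ι ι ℝ} {Ψ : Matrix ι ι ℝ →ₗ[ℝ] Matrix κ κ ℝ} {ε lam : ℝ}

namespace IsBalancedPair

theorem symm (h : IsBalancedPair Φ Ψ ε) : IsBalancedPair Ψ Φ ε where
  eps_nonneg := h.eps_nonneg
  left := h.right
  right := h.left
  inner_map X Y := by rw [real_inner_comm, ← h.inner_map, real_inner_comm]
  inner_one_map_one := by rw [real_inner_comm, ← h.inner_map, h.inner_one_map_one]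
  norm_map_le Y := by
    rcases (norm_nonneg (Ψ Y)).eq_or_lt with h0 | h0
    · exact h0 ▸ mul_nonneg (by linarith [h.eps_nonneg]) (norm_nonneg Y)
    · refine le_of_mul_le_mul_right ?_ h0
      calc ‖Ψ Y‖ * ‖Ψ Y‖ = ⟪Y, Φ (Ψ Y)⟫ := by rw [h.inner_map, real_inner_self_eq_norm_mul_norm]
        _ ≤ ‖Y‖ * ‖Φ (Ψ Y)‖ := real_inner_le_norm _ _
        _ ≤ ‖Y‖ * ((1 + ε) * ‖Ψ Y‖) := by gcongr; exact h.norm_map_le _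
        _ = (1 + ε) * ‖Y‖ * ‖Ψ Y‖ := by ring

theorem one_le_norm_map_one [Nonempty ι] (h : IsBalancedPair Φ Ψ ε) : 1 ≤ ‖Φ 1‖ := by
  simpa only [h.inner_one_map_one, norm_one_eq_one, one_mul] using
    real_inner_le_norm (1 : Matrix ι ι ℝ) (Φ 1)

theorem norm_map_map_one_sub_one_le [Nonempty κ] (h : IsBalancedPair Φ Ψ ε) (hε : ε ≤ 1) :
    ‖Ψ (Φ 1) - 1‖ ≤ 3 * ε := by
  have hε0 := h.eps_nonneg
  refine norm_sub_one_le_of_le (by linarith) ?_ ?_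
  · refine le_trans ?_ (h.right.smul_one_le_map (by linarith) h.left.lower)
    gcongr
    nlinarith
  · refine (h.right.map_le_smul_one (by linarith) h.left.upper).trans ?_
    gcongr
    nlinarith

theorem norm_map_le_of_inner_one_eq_zero [Nonempty ι] [Nonempty κ] (h : IsBalancedPair Φ Ψ ε)
    (hlam0 : 0 < lam) (hlam1 : lam ≤ 1) (hε : ε ≤ lam / 1000) {p : Matrix κ κ ℝ →ₗ[ℝ] ℝ}
    (hp : ∀ W, p W = 0 → ‖Φ W‖ ≤ (1 - lam) * ‖W‖) {D : Matrix κ κ ℝ} (hD : ⟪1, D⟫ = 0) :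
    ‖Φ D‖ ≤ (1 - 9 / 10 * lam) * ‖D‖ := by
  have hε0 := h.eps_nonneg
  have hcross : |⟪Φ 1, Φ D⟫| ≤ 3 * ε * ‖D‖ := by
    have : ⟪Φ 1, Φ D⟫ = ⟪Ψ (Φ 1) - 1, D⟫ := by rw [h.inner_map, inner_sub_left, hD, sub_zero]
    rw [this]
    exact (abs_real_inner_le_norm _ _).trans (mul_le_mul_of_nonneg_right
      (h.norm_map_map_one_sub_one_le (by linarith)) (norm_nonneg D))
  have hsq := norm_sq_map_le_of_gap (by linarith) (by linarith) hp norm_one_eq_one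
    h.one_le_norm_map_one hD hcross
  have hfactor : (1 - lam) ^ 2 + (3 * ε) ^ 2 / (1 - (1 - lam) ^ 2) ≤ (1 - 9 / 10 * lam) ^ 2 := by
    have : (3 * ε) ^ 2 / (1 - (1 - lam) ^ 2) ≤ lam / 100 := by
      rw [div_le_iff₀ (by nlinarith)]
      nlinarith [pow_le_pow_left₀ hε0 hε 2]
    nlinarith
  rw [← sq_le_sq₀ (norm_nonneg _) (mul_nonneg (by linarith) (norm_nonneg _)), mul_pow]
  exact hsq.trans (by gcongr)

end IsBalancedPair

end BalancedPair

section FixedPoint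

variable {α : Type*} [MetricSpace α] {S : Set α} {f : α → α} {q : ℝ} {x : α} {k K : ℕ}

theorem dist_iterate_succ_le (hq : 0 ≤ q)
    (hcontr : ∀ y ∈ S, f y ∈ S → dist (f y) (f (f y)) ≤ q * dist y (f y))
    (hx : ∀ j ≤ k, f^[j] x ∈ S) : dist (f^[k] x) (f^[k + 1] x) ≤ dist x (f x) * q ^ k := by
  induction k with
  | zero => simp
  | succ k ih =>
    have hk : f (f^[k] x) ∈ S := Function.iterate_succ_apply' f k x ▸ hx (k + 1) le_rfl
    rw [Function.iterate_succ_apply' f (k + 1), Function.iterate_succ_apply' f k]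
    calc dist (f (f^[k] x)) (f (f (f^[k] x))) ≤ q * dist (f^[k] x) (f (f^[k] x)) :=
          hcontr _ (hx k k.le_succ) hk
      _ ≤ q * (dist x (f x) * q ^ k) := by
          rw [← Function.iterate_succ_apply' f k]
          exact mul_le_mul_of_nonneg_left (ih fun j hj => hx j (hj.trans k.le_succ)) hq
      _ = dist x (f x) * q ^ (k + 1) := by ring

theorem iterate_mem_of_contracts_on (hq0 : 0 ≤ q) (hq1 : q < 1)
    (hcontr : ∀ y ∈ S, f y ∈ S → dist (f y) (f (f y)) ≤ q * dist y (f y))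
    (hstart : ∀ j ≤ K, f^[j] x ∈ S)
    (hstay : ∀ j, dist (f^[K] x) (f^[j] x) ≤ dist x (f x) * (q ^ K / (1 - q)) → f^[j] x ∈ S) :
    f^[k] x ∈ S := by
  induction k using Nat.strong_induction_on with
  | _ k ih =>
    rcases le_total k K with hkK | hKk
    · exact hstart k hkK
    · refine hstay k ?_
      calc dist (f^[K] x) (f^[k] x) ≤ ∑ j ∈ Finset.Ico K k, dist x (f x) * q ^ j :=
            dist_le_Ico_sum_of_dist_le (f := fun j => f^[j] x) hKk fun _ hj =>
              dist_iterate_succ_le hq0 hcontr fun i hi => ih i (hi.trans_lt hj)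
        _ ≤ dist x (f x) * (q ^ K / (1 - q)) := by
            rw [← Finset.mul_sum]
            exact mul_le_mul_of_nonneg_left (geom_sum_Ico_le_of_lt_one hq0 hq1) dist_nonneg

theorem exists_isFixedPt_of_contracts_on [CompleteSpace α] (hS : IsClosed S)
    (hf : ContinuousOn f S) (hq0 : 0 ≤ q) (hq1 : q < 1)
    (hcontr : ∀ y ∈ S, f y ∈ S → dist (f y) (f (f y)) ≤ q * dist y (f y))
    (hstart : ∀ j ≤ K, f^[j] x ∈ S)
    (hstay : ∀ j, dist (f^[K] x) (f^[j] x) ≤ dist x (f x) * (q ^ K / (1 - q)) → f^[j] x ∈ S) :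
    ∃ y ∈ S, Function.IsFixedPt f y := by
  have hmem (k : ℕ) : f^[k] x ∈ S := iterate_mem_of_contracts_on hq0 hq1 hcontr hstart hstay
  have hcauchy : CauchySeq fun k => f^[k] x :=
    cauchySeq_of_le_geometric q _ hq1 fun _ => dist_iterate_succ_le hq0 hcontr fun j _ => hmem j
  obtain ⟨y, hy⟩ := cauchySeq_tendsto_of_complete hcauchy
  have hyS : y ∈ S := hS.mem_of_tendsto hy (.of_forall hmem)
  refine ⟨y, hyS, tendsto_nhds_unique ?_ (hy.comp (Filter.tendsto_add_atTop_nat 1))⟩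
  simp only [Function.comp_def, Function.iterate_succ_apply']
  exact (hf y hyS).tendsto.comp (tendsto_nhdsWithin_iff.2 ⟨hy, .of_forall hmem⟩)

theorem mul_geometric_tail_le {x c μ : ℝ} (hμ0 : 0 < μ) (hμ1 : μ ≤ 1) (hc : 0 ≤ c)
    (hx : x ≤ Real.exp (μ * K)) :
    x * (c * (Real.exp (-μ) ^ K / (1 - Real.exp (-μ)))) ≤ 2 * c / μ := by
  have hratio : μ / 2 ≤ 1 - Real.exp (-μ) := by linarith [exp_neg_le_one_sub_half hμ0.le hμ1]
  calc x * (c * (Real.exp (-μ) ^ K / (1 - Real.exp (-μ))))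
      ≤ Real.exp (μ * K) * (c * (Real.exp (-μ) ^ K / (μ / 2))) := by
        have : 0 < 1 - Real.exp (-μ) := by linarith
        gcongr
    _ = 2 * c / μ * (Real.exp (μ * K) * Real.exp (-(μ * K))) := by
        rw [← Real.exp_nat_mul, mul_neg, mul_comm (K : ℝ)]
        field_simp
    _ = 2 * c / μ := by rw [← Real.exp_add, add_neg_cancel, Real.exp_zero, mul_one]

end FixedPoint

section Sinkhorn

variable {ι κ : Type*} [Fintype ι] [Fintype κ] [DecidableEq ι] [DecidableEq κ]
  {Φ : Matrix κ κ ℝ →ₗ[ℝ] Matrix ι ι ℝ} {Ψ : Matrix ι ι ℝ →ₗ[ℝ] Matrix κ κ ℝ} {ε μ t : ℝ}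

/-- One round of operator Sinkhorn scaling: a fixed point `Y` and `X = (Ψ Y)⁻¹` satisfy
`Φ X = Y⁻¹` and `Ψ Y = X⁻¹`. -/
noncomputable def sinkhornStep (Φ : Matrix κ κ ℝ →ₗ[ℝ] Matrix ι ι ℝ)
    (Ψ : Matrix ι ι ℝ →ₗ[ℝ] Matrix κ κ ℝ) (Y : Matrix ι ι ℝ) : Matrix ι ι ℝ :=
  (Φ (Ψ Y)⁻¹)⁻¹

namespace IsBalancedPair

variable {Y Y' : Matrix ι ι ℝ}

theorem logNear_sinkhornStep (h : IsBalancedPair Φ Ψ ε) (hε : ε ≤ 1 / 2) (hY : LogNear t Y) :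
    LogNear (t + 4 * ε) (sinkhornStep Φ Ψ Y) := by
  have hX := (h.right.logNear_map h.eps_nonneg hε hY).inv
  exact (h.left.logNear_map h.eps_nonneg hε hX).inv.mono (by linarith)

theorem logNear_iterate_sinkhornStep (h : IsBalancedPair Φ Ψ ε) (hε : ε ≤ 1 / 2) (k : ℕ) :
    LogNear (4 * ε * k) ((sinkhornStep Φ Ψ)^[k] 1) := by
  induction k with
  | zero => simpa using LogNear.zero_one
  | succ k ih =>
    rw [Function.iterate_succ_apply']
    exact (h.logNear_sinkhornStep hε ih).mono (by push_cast; linarith)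

theorem norm_sinkhornStep_one_sub_one_le [Nonempty ι] (h : IsBalancedPair Φ Ψ ε) (hε : ε ≤ 1 / 4) :
    ‖sinkhornStep Φ Ψ 1 - 1‖ ≤ 8 * ε := by
  have := (h.logNear_sinkhornStep (by linarith) LogNear.zero_one).norm_sub_one_le (by linarith)
  linarith

theorem norm_inv_map_sub_inv_map_le (h : IsBalancedPair Φ Ψ ε) (hε : ε ≤ 1 / 2)
    (hY : LogNear t Y) (hY' : LogNear t Y') :
    ‖(Ψ Y)⁻¹ - (Ψ Y')⁻¹‖ ≤ Real.exp (2 * (t + 2 * ε)) * ((1 + ε) * ‖Y - Y'‖) :=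
  (h.right.norm_inv_map_sub_inv_map_le h.eps_nonneg hε hY hY').trans
    (mul_le_mul_of_nonneg_left (h.symm.norm_map_le _) (Real.exp_pos _).le)

theorem continuousOn_inv_map (h : IsBalancedPair Φ Ψ ε) (hε : ε ≤ 1 / 2) :
    ContinuousOn (fun Y => (Ψ Y)⁻¹) {Y | LogNear t Y} := by
  refine (LipschitzOnWith.of_dist_le_mul (K := Real.toNNReal
    (Real.exp (2 * (t + 2 * ε)) * (1 + ε))) fun Y hY Y' hY' => ?_).continuousOn
  rw [dist_eq_norm, dist_eq_norm, Real.coe_toNNReal _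
    (mul_nonneg (Real.exp_pos _).le (by linarith [h.eps_nonneg])), mul_assoc]
  exact h.norm_inv_map_sub_inv_map_le hε hY hY'

theorem continuousOn_sinkhornStep (h : IsBalancedPair Φ Ψ ε) (hε : ε ≤ 1 / 2) :
    ContinuousOn (sinkhornStep Φ Ψ) {Y | LogNear t Y} :=
  (h.symm.continuousOn_inv_map (t := t + 2 * ε) hε).comp (h.continuousOn_inv_map hε)
    fun _ hY => (h.right.logNear_map h.eps_nonneg hε hY).inv

theorem inner_map_sinkhornStep_sub_eq_zero [Nonempty ι] [Nonempty κ] (h : IsBalancedPair Φ Ψ ε)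
    (hε : ε ≤ 1 / 2) (hY : LogNear t Y) (hY' : LogNear t (sinkhornStep Φ Ψ Y)) :
    ⟪Ψ (sinkhornStep Φ Ψ Y), (Ψ Y)⁻¹ - (Ψ (sinkhornStep Φ Ψ Y))⁻¹⟫ = 0 := by
  have hX := (h.right.logNear_map h.eps_nonneg hε hY).inv
  have hΦX := (h.left.logNear_map h.eps_nonneg hε hX).posDef
  have hΨY' := (h.right.logNear_map h.eps_nonneg hε hY').posDef
  have hleft : ⟪sinkhornStep Φ Ψ Y, Φ (Ψ Y)⁻¹⟫ = 1 := inner_inv_left_eq_one hΦX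
  rw [inner_sub_right, ← h.inner_map, hleft, inner_inv_right_eq_one hΨY', sub_self]

end IsBalancedPair

/-- A balanced pair whose first map contracts the orthogonal complement of the identity by the
factor `1 - μ`, with an imbalance `ε` that is small compared with `μ`. -/
structure IsGappedPair (Φ : Matrix κ κ ℝ →ₗ[ℝ] Matrix ι ι ℝ) (Ψ : Matrix ι ι ℝ →ₗ[ℝ] Matrix κ κ ℝ)
    (ε μ : ℝ) : Prop extends IsBalancedPair Φ Ψ ε where
  gap_pos : 0 < μ
  gap_le_one : μ ≤ 1
  eps_le : ε ≤ μ / 1000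
  norm_map_le_of_inner_one_eq_zero : ∀ D, ⟪1, D⟫ = 0 → ‖Φ D‖ ≤ (1 - μ) * ‖D‖

namespace IsGappedPair

theorem norm_map_le_of_inner_eq_zero [Nonempty κ] (h : IsGappedPair Φ Ψ ε μ)
    {P D : Matrix κ κ ℝ} (hP : LogNear t P) (ht : t ≤ 1) (hD : ⟪P, D⟫ = 0) :
    ‖Φ D‖ ≤ (1 - μ + 2 * t * (1 + ε)) * ‖D‖ := by
  have hμ := h.gap_le_one
  set c := ⟪1, D⟫ with hc
  have hc_le : |c| ≤ 2 * t * ‖D‖ := by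
    have : c = -⟪P - 1, D⟫ := by rw [inner_sub_left, hD, zero_sub, neg_neg]
    rw [this, abs_neg]
    exact (abs_real_inner_le_norm _ _).trans
      (mul_le_mul_of_nonneg_right (hP.norm_sub_one_le ht) (norm_nonneg D))
  have horth : ⟪1, D - c • 1⟫ = 0 := by
    rw [inner_sub_right, inner_one_left_smul_one, hc, sub_self]
  have hproj : ‖D - c • 1‖ ≤ ‖D‖ := by
    have : ‖D‖ ^ 2 = ‖D - c • 1‖ ^ 2 + ‖c • (1 : Matrix κ κ ℝ)‖ ^ 2 := by
      rw [← sub_add_cancel D (c • 1), norm_add_sq_real, real_inner_smul_right, real_inner_comm,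
        sub_add_cancel, horth, mul_zero, mul_zero, add_zero]
    exact le_of_sq_le_sq (by nlinarith) (norm_nonneg D)
  calc ‖Φ D‖ = ‖Φ (D - c • 1) + c • Φ 1‖ := by rw [← map_smul, ← map_add, sub_add_cancel]
    _ ≤ ‖Φ (D - c • 1)‖ + |c| * ‖Φ 1‖ := by
        rw [← Real.norm_eq_abs, ← norm_smul]
        exact norm_add_le _ _
    _ ≤ (1 - μ) * ‖D‖ + 2 * t * ‖D‖ * (1 + ε) := by
        have hΦ1 : ‖Φ 1‖ ≤ 1 + ε := by simpa [norm_one_eq_one] using h.norm_map_le 1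
        have ht0 := hP.nonneg
        gcongr
        exact (h.norm_map_le_of_inner_one_eq_zero _ horth).trans (by gcongr)
    _ = (1 - μ + 2 * t * (1 + ε)) * ‖D‖ := by ring

theorem norm_sinkhornStep_sub_le [Nonempty ι] [Nonempty κ] (h : IsGappedPair Φ Ψ ε μ)
    {Y : Matrix ι ι ℝ} (hY : LogNear (μ / 200) Y) (hY' : LogNear (μ / 200) (sinkhornStep Φ Ψ Y)) :
    ‖sinkhornStep Φ Ψ Y - sinkhornStep Φ Ψ (sinkhornStep Φ Ψ Y)‖ ≤
      Real.exp (-(μ / 2)) * ‖Y - sinkhornStep Φ Ψ Y‖ := by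
  have hε0 := h.eps_nonneg
  have hμ1 := h.gap_le_one
  have hε := h.eps_le
  have horth := h.inner_map_sinkhornStep_sub_eq_zero (by linarith) hY hY'
  set Y' := sinkhornStep Φ Ψ Y
  set X := (Ψ Y)⁻¹
  set X' := (Ψ Y')⁻¹
  have hP : LogNear (μ / 200 + 2 * ε) (Ψ Y) := h.right.logNear_map hε0 (by linarith) hY
  have hP' : LogNear (μ / 200 + 2 * ε) (Ψ Y') := h.right.logNear_map hε0 (by linarith) hY'
  have hgap : ‖Φ (X - X')‖ ≤ Real.exp (-(49 / 50 * μ)) * ‖X - X'‖ := by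
    refine (h.norm_map_le_of_inner_eq_zero hP' (by linarith) horth).trans ?_
    gcongr
    nlinarith [Real.add_one_le_exp (-(49 / 50 * μ))]
  calc ‖Y' - sinkhornStep Φ Ψ Y'‖
      ≤ Real.exp (2 * (μ / 200 + 2 * ε + 2 * ε)) * ‖Φ (X - X')‖ :=
        h.left.norm_inv_map_sub_inv_map_le hε0 (by linarith) hP.inv hP'.inv
    _ ≤ Real.exp (2 * (μ / 200 + 2 * ε + 2 * ε)) * (Real.exp (-(49 / 50 * μ)) *
          (Real.exp (2 * (μ / 200 + 2 * ε)) * (Real.exp ε * ‖Y - Y'‖))) := by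
        gcongr
        refine hgap.trans ?_
        gcongr
        refine (h.norm_inv_map_sub_inv_map_le (by linarith) hY hY').trans ?_
        gcongr
        linarith [Real.add_one_le_exp ε]
    _ = Real.exp (2 * (μ / 200 + 2 * ε + 2 * ε) + -(49 / 50 * μ) + 2 * (μ / 200 + 2 * ε) + ε) *
          ‖Y - Y'‖ := by
        rw [Real.exp_add, Real.exp_add, Real.exp_add]
        ring
    _ ≤ Real.exp (-(μ / 2)) * ‖Y - Y'‖ := by
        gcongr
        linarith

theorem exists_isFixedPt_sinkhornStep [Nonempty ι] [Nonempty κ] (h : IsGappedPair Φ Ψ ε μ) {K : ℕ}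
    (hK : 1600 * (ε * K) ≤ μ) (hcard : √(Fintype.card ι) ≤ Real.exp (μ / 2 * K))
    (hεμ : 51200 * ε ≤ μ ^ 2) :
    ∃ Y, LogNear (μ / 200) Y ∧ sinkhornStep Φ Ψ Y = Y := by
  have hε0 := h.eps_nonneg
  have hμ0 := h.gap_pos
  have hμ1 := h.gap_le_one
  have hε := h.eps_le
  have hiter := h.logNear_iterate_sinkhornStep (by linarith)
  have hnear {j : ℕ} (hj : j ≤ K) : LogNear (μ / 400) ((sinkhornStep Φ Ψ)^[j] 1) := by
    refine (hiter j).mono ?_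
    have : ε * j ≤ ε * K := by gcongr
    linarith
  have hfirst : dist 1 (sinkhornStep Φ Ψ 1) ≤ 8 * ε := by
    rw [dist_comm, dist_eq_norm]
    exact h.norm_sinkhornStep_one_sub_one_le (by linarith)
  refine exists_isFixedPt_of_contracts_on (S := {Y | LogNear (μ / 200) Y}) (K := K) (x := 1)
    (q := Real.exp (-(μ / 2))) (LogNear.isClosed_setOf _)
    (h.continuousOn_sinkhornStep (by linarith)) (Real.exp_pos _).le
    (Real.exp_lt_one_iff.2 (by linarith)) (fun Y hY hY' => ?_)
    (fun j hj => (hnear hj).mono (by linarith)) fun j hj => ?_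
  · simpa only [dist_eq_norm] using h.norm_sinkhornStep_sub_le hY hY'
  · have hdist : √(Fintype.card ι) * ‖(sinkhornStep Φ Ψ)^[j] 1 - (sinkhornStep Φ Ψ)^[K] 1‖ ≤
        μ / 1600 := by
      rw [← dist_eq_norm, dist_comm]
      calc √(Fintype.card ι) * dist ((sinkhornStep Φ Ψ)^[K] 1) ((sinkhornStep Φ Ψ)^[j] 1)
          ≤ √(Fintype.card ι) * (dist 1 (sinkhornStep Φ Ψ 1) *
              (Real.exp (-(μ / 2)) ^ K / (1 - Real.exp (-(μ / 2))))) := by gcongr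
        _ ≤ 2 * dist 1 (sinkhornStep Φ Ψ 1) / (μ / 2) :=
            mul_geometric_tail_le (by linarith) (by linarith) dist_nonneg hcard
        _ ≤ μ / 1600 := by
            rw [div_le_iff₀ (by linarith)]
            linarith
    have := (hnear le_rfl).add (by linarith) ((hiter j).posDef.isHermitian.sub
      (hiter K).posDef.isHermitian) hdist (by linarith)
    rw [add_sub_cancel] at this
    exact this.mono (by linarith)

end IsGappedPair

end Sinkhorn

section Potential

theorem log_det_smul_div {ι : Type*} [Fintype ι] [DecidableEq ι] [Nonempty ι] {P : Matrix ι ι ℝ}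
    (hP : P.PosDef) {c : ℝ} (hc : 0 < c) :
    Real.log (c • P).det / Fintype.card ι = Real.log c + Real.log P.det / Fintype.card ι := by
  rw [Matrix.det_smul, Real.log_mul (pow_pos hc _).ne' hP.det_pos.ne', Real.log_pow, add_div,
    mul_div_cancel_left₀ _ (Nat.cast_ne_zero.2 Fintype.card_ne_zero)]

theorem LogNear.log_det_div_le {ι : Type*} [Fintype ι] [DecidableEq ι] [Nonempty ι] {t : ℝ}
    {P : Matrix ι ι ℝ} (h : LogNear t P) (ht : t ≤ 1 / 4) :
    Real.log P.det / Fintype.card ι ≤ ⟪1, P - 1⟫ - (1 / 2 - 4 * t) * ‖P - 1‖ ^ 2 := by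
  have := (abs_le.1 (abs_log_det_sub_quadratic_le (by linarith) h.one_sub_smul_one_le
    (h.le_one_add_smul_one (by linarith)))).2
  linarith

namespace IsGappedPair

variable {ι κ : Type*} [Fintype ι] [Fintype κ] [DecidableEq ι] [DecidableEq κ]
  {Φ : Matrix κ κ ℝ →ₗ[ℝ] Matrix ι ι ℝ} {Ψ : Matrix ι ι ℝ →ₗ[ℝ] Matrix κ κ ℝ} {ε μ : ℝ}
  {X : Matrix κ κ ℝ} {Y : Matrix ι ι ℝ}

theorem inner_one_sub_one_le [Nonempty ι] [Nonempty κ] (h : IsGappedPair Φ Ψ ε μ)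
    (hX : ⟪1, X⟫ = 1) (hYX : ⟪Y, Φ X⟫ = 1) :
    ⟪1, Y - 1⟫ ≤ ε * (‖X - 1‖ + ‖Y - 1‖) + (1 - μ) * (‖X - 1‖ * ‖Y - 1‖) := by
  have horth : ⟪1, X - 1⟫ = 0 := by
    rw [inner_sub_right, hX, real_inner_self_eq_norm_sq, norm_one_eq_one, one_pow, sub_self]
  have expand : ⟪1, Y - 1⟫ =
      -⟪Ψ 1 - 1, X - 1⟫ - ⟪Φ 1 - 1, Y - 1⟫ - ⟪Y - 1, Φ (X - 1)⟫ := by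
    have hΦ1 := h.inner_one_map_one
    have hΦ1' : ⟪Φ 1, 1⟫ = 1 := (real_inner_comm _ _).trans hΦ1
    rw [inner_sub_left _ _ (X - 1), horth, ← h.inner_map]
    simp only [map_sub, inner_sub_left, inner_sub_right, hYX, hΦ1, hΦ1',
      real_inner_comm Y (Φ 1)]
    ring
  have hΨ1 : |⟪Ψ 1 - 1, X - 1⟫| ≤ ε * ‖X - 1‖ := (abs_real_inner_le_norm _ _).trans
    (by gcongr; exact h.right.norm_map_one_sub_one_le h.eps_nonneg)
  have hΦ1 : |⟪Φ 1 - 1, Y - 1⟫| ≤ ε * ‖Y - 1‖ := (abs_real_inner_le_norm _ _).trans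
    (by gcongr; exact h.left.norm_map_one_sub_one_le h.eps_nonneg)
  have hcross : |⟪Y - 1, Φ (X - 1)⟫| ≤ ‖Y - 1‖ * ((1 - μ) * ‖X - 1‖) :=
    (abs_real_inner_le_norm _ _).trans
      (by gcongr; exact h.norm_map_le_of_inner_one_eq_zero _ horth)
  rw [abs_le] at hΨ1 hΦ1 hcross
  linarith

theorem log_det_add_log_det_le_of_inner_one_eq_one [Nonempty ι] [Nonempty κ]
    (h : IsGappedPair Φ Ψ ε μ) (hX : LogNear (μ / 60) X) (hY : LogNear (μ / 60) Y)
    (hX1 : ⟪1, X⟫ = 1) (hYX : ⟪Y, Φ X⟫ = 1) :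
    Real.log X.det / Fintype.card κ + Real.log Y.det / Fintype.card ι ≤ 2 * ε ^ 2 / μ := by
  have hμ0 := h.gap_pos
  have hμ1 := h.gap_le_one
  have hlogX := hX.log_det_div_le (by linarith)
  have hlogY := hY.log_det_div_le (by linarith)
  have hinner := h.inner_one_sub_one_le hX1 hYX
  rw [inner_sub_right, hX1, real_inner_self_eq_norm_sq, norm_one_eq_one] at hlogX
  set a := ‖X - 1‖
  set b := ‖Y - 1‖
  calc Real.log X.det / Fintype.card κ + Real.log Y.det / Fintype.card ι
      ≤ ε * (a + b) + (1 - μ) * (a * b) - (1 / 2 - μ / 15) * (a ^ 2 + b ^ 2) := by linarith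
    _ ≤ ε * (a + b) - 13 / 60 * μ * (a + b) ^ 2 := by nlinarith [sq_nonneg (a - b)]
    _ ≤ 2 * ε ^ 2 / μ := by
        rw [le_div_iff₀ hμ0]
        nlinarith [sq_nonneg (μ * (a + b) - 2 * ε)]

-- Replacing `(X, Y)` by `(c⁻¹ X, c Y)` changes neither side, so we may assume `⟪1, X⟫ = 1`.
theorem log_det_add_log_det_le [Nonempty ι] [Nonempty κ] (h : IsGappedPair Φ Ψ ε μ)
    (hX : LogNear (μ / 140) X) (hY : LogNear (μ / 140) Y) (hYX : ⟪Y, Φ X⟫ = 1) :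
    Real.log X.det / Fintype.card κ + Real.log Y.det / Fintype.card ι ≤ 2 * ε ^ 2 / μ := by
  have hμ0 := h.gap_pos
  have hlog := hX.abs_log_inner_one_le
  have hc := hX.inner_one_pos
  set c := ⟪1, X⟫ with hc_def
  have hX' : LogNear (μ / 60) (c⁻¹ • X) :=
    (hX.smul (inv_pos.2 hc)).mono (by rw [Real.log_inv, abs_neg]; linarith)
  have hY' : LogNear (μ / 60) (c • Y) := (hY.smul hc).mono (by linarith)
  have := h.log_det_add_log_det_le_of_inner_one_eq_one hX' hY'
    (by rw [real_inner_smul_right, ← hc_def, inv_mul_cancel₀ hc.ne'])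
    (by rw [map_smul, real_inner_smul_left, real_inner_smul_right, hYX, mul_one,
      mul_inv_cancel₀ hc.ne'])
  rw [log_det_smul_div hX.posDef (inv_pos.2 hc), log_det_smul_div hY.posDef hc,
    Real.log_inv] at this
  linarith

theorem exists_scaling [Nonempty ι] [Nonempty κ] (h : IsGappedPair Φ Ψ ε μ) {K : ℕ}
    (hK : 1600 * (ε * K) ≤ μ) (hcard : √(Fintype.card ι) ≤ Real.exp (μ / 2 * K))
    (hεμ : 51200 * ε ≤ μ ^ 2) :
    ∃ X Y, X.PosDef ∧ Y.PosDef ∧ Φ X = Y⁻¹ ∧ Ψ Y = X⁻¹ ∧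
      Real.log X.det / Fintype.card κ + Real.log Y.det / Fintype.card ι ≤ 2 * ε ^ 2 / μ := by
  have hε0 := h.eps_nonneg
  have hμ1 := h.gap_le_one
  have hε := h.eps_le
  obtain ⟨Y, hY, hfix⟩ := h.exists_isFixedPt_sinkhornStep hK hcard hεμ
  have hΨY : LogNear (μ / 140) (Ψ Y) :=
    (h.right.logNear_map hε0 (by linarith) hY).mono (by linarith)
  have hX := hΨY.inv
  have hΦX : Φ (Ψ Y)⁻¹ = Y⁻¹ := by
    have hdet := (h.left.logNear_map hε0 (by linarith) hX).posDef.det_pos.ne'.isUnit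
    rw [← Matrix.nonsing_inv_nonsing_inv _ hdet]
    exact congrArg _ hfix
  have hΨY_inv : Ψ Y = (Ψ Y)⁻¹⁻¹ :=
    (Matrix.nonsing_inv_nonsing_inv _ hΨY.posDef.det_pos.ne'.isUnit).symm
  refine ⟨(Ψ Y)⁻¹, Y, hX.posDef, hY.posDef, hΦX, hΨY_inv,
    h.log_det_add_log_det_le hX (hY.mono (by linarith)) ?_⟩
  rw [hΦX, inner_inv_right_eq_one hY.posDef]

end IsGappedPair

end Potential

section ScaledMap

variable {ι κ : Type*} [Fintype ι] [Fintype κ] [DecidableEq ι] [DecidableEq κ]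
  {Φ : Matrix κ κ ℝ →ₗ[ℝ] Matrix ι ι ℝ} {Ψ : Matrix ι ι ℝ →ₗ[ℝ] Matrix κ κ ℝ}
  {S : Matrix κ κ ℝ} {T : Matrix ι ι ℝ} {X₀ X : Matrix κ κ ℝ} {Y₀ : Matrix ι ι ℝ}

/-- Operator scaling by the pair `(S, T)`: the `Aᵢ` of `Φ(X) = ∑ᵢ Aᵢ X Aᵢ*` become `T Aᵢ S*`. -/
noncomputable def scaledMap (Φ : Matrix κ κ ℝ →ₗ[ℝ] Matrix ι ι ℝ) (S : Matrix κ κ ℝ)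
    (T : Matrix ι ι ℝ) : Matrix κ κ ℝ →ₗ[ℝ] Matrix ι ι ℝ :=
  LinearMap.mulLeftRight ℝ (T, star T) ∘ₗ Φ ∘ₗ LinearMap.mulLeftRight ℝ (star S, S)

theorem scaledMap_apply (X : Matrix κ κ ℝ) :
    scaledMap Φ S T X = T * Φ (star S * X * S) * star T := by
  simp [scaledMap, LinearMap.mulLeftRight_apply]

theorem mul_inv_star_mul_self_mul_star (hS : IsUnit S) : S * (star S * S)⁻¹ * star S = 1 := by
  have hdet := (Matrix.isUnit_iff_isUnit_det S).1 hS
  have hdet' := (Matrix.isUnit_iff_isUnit_det _).1 hS.star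
  rw [Matrix.mul_inv_rev, ← mul_assoc, S.mul_nonsing_inv hdet, one_mul,
    (star S).nonsing_inv_mul hdet']

theorem scaledMap_nonneg (hΦ : ∀ X, 0 ≤ X → 0 ≤ Φ X) (hX : 0 ≤ X) : 0 ≤ scaledMap Φ S T X := by
  rw [scaledMap_apply]
  exact star_right_conjugate_nonneg (hΦ _ (star_left_conjugate_nonneg hX S)) T

theorem scaledMap_one (hT : IsUnit T) (hΦ : Φ (star S * S) = (star T * T)⁻¹) :
    scaledMap Φ S T 1 = 1 := by
  rw [scaledMap_apply, mul_one, hΦ, mul_inv_star_mul_self_mul_star hT]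

theorem trace_scaledMap_div (hΦΨ : ∀ Y X, ⟪Y, Φ X⟫ = ⟪Ψ Y, X⟫) (hS : IsUnit S)
    (hΨ : Ψ (star T * T) = (star S * S)⁻¹) :
    (scaledMap Φ S T X).trace / Fintype.card ι = X.trace / Fintype.card κ := by
  have hT : (star T * T).IsHermitian := Matrix.isHermitian_conjTranspose_mul_self T
  have hS' : (star S * S)⁻¹.IsHermitian := (Matrix.isHermitian_conjTranspose_mul_self S).inv
  have hadj := hΦΨ (star T * T) (star S * X * S)
  rw [hΨ, inner_eq_trace, inner_eq_trace, transpose_eq_of_isHermitian hT,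
    transpose_eq_of_isHermitian hS'] at hadj
  calc (scaledMap Φ S T X).trace / Fintype.card ι
      = (star T * T * Φ (star S * X * S)).trace / Fintype.card ι := by
        rw [scaledMap_apply, Matrix.trace_mul_cycle, mul_assoc]
    _ = (S * (star S * S)⁻¹ * star S * X).trace / Fintype.card κ := by
        rw [hadj, ← mul_assoc, Matrix.trace_mul_comm _ S]
        simp only [mul_assoc]
    _ = X.trace / Fintype.card κ := by rw [mul_inv_star_mul_self_mul_star hS, one_mul]

theorem log_det_conjugate (hS : IsUnit S) (hX : X.PosDef) :
    Real.log (star S * X * S).det = Real.log (star S * S).det + Real.log X.det := by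
  have hdet := ((Matrix.isUnit_iff_isUnit_det S).1 hS).ne_zero
  have hdet' := ((Matrix.isUnit_iff_isUnit_det _).1 hS.star).ne_zero
  rw [← Real.log_mul (Matrix.det_mul (star S) S ▸ mul_ne_zero hdet' hdet) hX.det_pos.ne',
    Matrix.det_mul, Matrix.det_mul, Matrix.det_mul]
  ring_nf

-- The capacity is attained at a solution `X₀`, `Y₀` of the scaling equations.
theorem log_det_sub_le_log_det_map (hΦ : ∀ X, 0 ≤ X → 0 ≤ Φ X)
    (hΦΨ : ∀ Y X, ⟪Y, Φ X⟫ = ⟪Ψ Y, X⟫) (hX₀ : X₀.PosDef) (hY₀ : Y₀.PosDef) (hΦX₀ : Φ X₀ = Y₀⁻¹)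
    (hΨY₀ : Ψ Y₀ = X₀⁻¹) (hX : X.PosDef) :
    (Φ X).PosDef ∧
      Real.log X.det / Fintype.card κ -
          (Real.log X₀.det / Fintype.card κ + Real.log Y₀.det / Fintype.card ι) ≤
        Real.log (Φ X).det / Fintype.card ι := by
  obtain ⟨S, hS, rfl⟩ := exists_eq_star_mul_self hX₀
  obtain ⟨T, hT, rfl⟩ := exists_eq_star_mul_self hY₀
  obtain ⟨Z, rfl⟩ : ∃ Z, star S * Z * S = X := by
    obtain ⟨S, rfl⟩ := hS
    exact ⟨star (S⁻¹ : (Matrix κ κ ℝ)ˣ).1 * X * (S⁻¹ : (Matrix κ κ ℝ)ˣ).1, by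
      simp [← mul_assoc, ← star_mul]⟩
  have hZ : Z.PosDef := (Matrix.IsUnit.posDef_star_left_conjugate_iff hS).1 hX
  have hmap1 := scaledMap_one hT hΦX₀
  have hmapZ : (scaledMap Φ S T Z).PosDef :=
    posDef_map (fun _ => scaledMap_nonneg hΦ) hmap1 hZ
  have hjensen := log_det_div_le_log_det_map_div (fun _ => scaledMap_nonneg hΦ) hmap1
    (fun _ => trace_scaledMap_div hΦΨ hS hΨY₀) hZ
  rw [scaledMap_apply] at hmapZ hjensen
  have hΦX : (Φ (star S * Z * S)).PosDef :=
    (Matrix.IsUnit.posDef_star_right_conjugate_iff hT).1 hmapZ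
  refine ⟨hΦX, ?_⟩
  have hleft := log_det_conjugate hT.star hΦX
  rw [star_star, Matrix.det_mul_comm T (star T)] at hleft
  rw [hleft, add_div] at hjensen
  rw [log_det_conjugate hS hZ, add_div]
  linarith

end ScaledMap

section SingularValues

-- `v` is a right singular vector for the largest singular value.
theorem exists_forall_inner_eq_zero_norm_le {E F : Type*} [NormedAddCommGroup E]
    [InnerProductSpace ℝ E] [FiniteDimensional ℝ E] [NormedAddCommGroup F]
    [InnerProductSpace ℝ F] [FiniteDimensional ℝ F] (T : E →ₗ[ℝ] F) :
    ∃ v : E, ∀ w, ⟪v, w⟫ = 0 → ‖T w‖ ≤ T.singularValues 1 * ‖w‖ := by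
  rcases Nat.eq_zero_or_pos (Module.finrank ℝ E) with hE | hE
  · have : Subsingleton E := Module.finrank_zero_iff.1 hE
    exact ⟨0, fun w _ => by simp [Subsingleton.elim w 0]⟩
  set b := T.isSymmetric_adjoint_comp_self.eigenvectorBasis rfl
  refine ⟨b ⟨0, hE⟩, fun w hw => ?_⟩
  have norm_sq_map : ‖T w‖ ^ 2 =
      ∑ i : Fin (Module.finrank ℝ E), T.singularValues i ^ 2 * ⟪b i, w⟫ ^ 2 := by
    rw [← real_inner_self_eq_norm_sq, ← LinearMap.adjoint_inner_right, ← LinearMap.comp_apply,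
      ← b.sum_inner_mul_inner]
    refine Finset.sum_congr rfl fun i _ => ?_
    rw [T.sq_singularValues_fin rfl, ← T.isSymmetric_adjoint_comp_self (b i) w,
      T.isSymmetric_adjoint_comp_self.apply_eigenvectorBasis rfl i, real_inner_smul_left,
      real_inner_comm w, RCLike.ofReal_real_eq_id, id]
    ring
  have norm_sq : ‖w‖ ^ 2 = ∑ i, ⟪b i, w⟫ ^ 2 := by
    simp only [← b.sum_sq_norm_inner_right w, Real.norm_eq_abs, sq_abs]
  rw [← sq_le_sq₀ (norm_nonneg _) (mul_nonneg (T.singularValues_nonneg 1) (norm_nonneg w)),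
    mul_pow, norm_sq_map, norm_sq, Finset.mul_sum]
  refine Finset.sum_le_sum fun i _ => ?_
  rcases eq_or_ne i ⟨0, hE⟩ with rfl | hi
  · simp [hw]
  · have : 1 ≤ (i : ℕ) := Nat.one_le_iff_ne_zero.2 fun h => hi (Fin.ext h)
    gcongr
    exacts [T.singularValues_nonneg _, T.singularValues_antitone this]

end SingularValues

section CompletelyPositiveMap

variable {k m n : ℕ}

/-- The tuple `(A₁*, …, A_k*)`, whose completely positive map is the adjoint of that of `A`. -/
def Operator.transpose (A : Operator k m n) : Operator k n m := fun i => (A i)ᵀ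

theorem cpMap_transpose (A : Operator k m n) : cpMap A.transpose = cpMapAdjoint A := by
  funext Y
  simp only [cpMap, cpMapAdjoint, Operator.transpose, Matrix.transpose_transpose]

theorem cpMapAdjoint_transpose (A : Operator k m n) : cpMapAdjoint A.transpose = cpMap A := by
  funext X
  simp only [cpMap, cpMapAdjoint, Operator.transpose, Matrix.transpose_transpose]

theorem size_transpose (A : Operator k m n) : size A.transpose = size A :=
  Finset.sum_congr rfl fun _ _ => Finset.sum_comm

theorem size_nonneg (A : Operator k m n) : 0 ≤ size A := by
  unfold size
  positivity

theorem IsNearlyDoublyBalanced.transpose {A : Operator k m n} {ε : ℝ}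
    (h : IsNearlyDoublyBalanced A ε) : IsNearlyDoublyBalanced A.transpose ε where
  left_lower := by simpa only [cpMap_transpose, size_transpose] using h.right_lower
  left_upper := by simpa only [cpMap_transpose, size_transpose] using h.right_upper
  right_lower := by simpa only [cpMapAdjoint_transpose, size_transpose] using h.left_lower
  right_upper := by simpa only [cpMapAdjoint_transpose, size_transpose] using h.left_upper

theorem cpMap_nonneg (A : Operator k m n) {X : Matrix (Fin n) (Fin n) ℝ} (hX : 0 ≤ X) :
    0 ≤ cpMap A X := by
  rw [Matrix.nonneg_iff_posSemidef] at hX ⊢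
  refine Matrix.posSemidef_sum _ fun i _ => ?_
  simpa only [Matrix.conjTranspose_eq_transpose_of_trivial] using
    hX.mul_mul_conjTranspose_same (A i)

theorem trace_cpMap_one (A : Operator k m n) : (cpMap A 1).trace = size A := by
  rw [cpMap, Matrix.trace_sum]
  exact Finset.sum_congr rfl fun i _ => by simp [Matrix.trace, Matrix.mul_apply, sq]

theorem trace_transpose_mul_cpMap (A : Operator k m n) (Y : Matrix (Fin m) (Fin m) ℝ)
    (X : Matrix (Fin n) (Fin n) ℝ) :
    (Yᵀ * cpMap A X).trace = ((cpMapAdjoint A Y)ᵀ * X).trace := by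
  simp only [cpMap, cpMapAdjoint, Finset.mul_sum, Matrix.trace_sum, Matrix.transpose_sum,
    Finset.sum_mul]
  refine Finset.sum_congr rfl fun i _ => ?_
  rw [Matrix.transpose_mul, Matrix.transpose_mul, Matrix.transpose_transpose,
    ← Matrix.mul_assoc, Matrix.trace_mul_comm]
  simp only [Matrix.mul_assoc]

theorem sum_trace_mul_sq_le {α p q : Type*} [Fintype α] [Fintype p] [Fintype q]
    (B : α → Matrix p q ℝ) (C : α → Matrix q p ℝ) :
    (∑ i, (B i * C i).trace) ^ 2 ≤
      (∑ i, (B i * (B i)ᵀ).trace) * ∑ i, ((C i)ᵀ * C i).trace := by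
  have := Finset.sum_mul_sq_le_sq_mul_sq Finset.univ
    (fun x : α × p × q => B x.1 x.2.1 x.2.2) (fun x => C x.1 x.2.2 x.2.1)
  simpa [Fintype.sum_prod_type, Matrix.trace, Matrix.mul_apply, sq] using this

theorem trace_transpose_mul_cpMap_sq_le (A : Operator k m n) (Y : Matrix (Fin m) (Fin m) ℝ)
    (X : Matrix (Fin n) (Fin n) ℝ) :
    (Yᵀ * cpMap A X).trace ^ 2 ≤
      (Yᵀ * (cpMap A 1 * Y)).trace * (X * (cpMapAdjoint A 1 * Xᵀ)).trace := by
  have hleft : (Yᵀ * cpMap A X).trace = ∑ i, (Yᵀ * A i * (X * (A i)ᵀ)).trace := by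
    simp only [cpMap, Finset.mul_sum, Matrix.trace_sum, Matrix.mul_assoc]
  have hY : (Yᵀ * (cpMap A 1 * Y)).trace = ∑ i, (Yᵀ * A i * (Yᵀ * A i)ᵀ).trace := by
    simp only [cpMap, Finset.mul_sum, Finset.sum_mul, Matrix.trace_sum, Matrix.mul_assoc,
      Matrix.one_mul, Matrix.transpose_mul, Matrix.transpose_transpose]
  have hX : (X * (cpMapAdjoint A 1 * Xᵀ)).trace = ∑ i, ((X * (A i)ᵀ)ᵀ * (X * (A i)ᵀ)).trace := by
    simp only [cpMapAdjoint, Finset.mul_sum, Finset.sum_mul, Matrix.trace_sum, Matrix.mul_one]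
    refine Finset.sum_congr rfl fun i _ => ?_
    rw [Matrix.trace_mul_comm (X * (A i)ᵀ)ᵀ, Matrix.transpose_mul, Matrix.transpose_transpose]
    simp only [Matrix.mul_assoc]
  rw [hleft, hY, hX]
  exact sum_trace_mul_sq_le _ _

end CompletelyPositiveMap

section NormalizedMap

variable {k m n : ℕ} {A : Operator k m n} {ε : ℝ}

/-- The completely positive map of `A`, scaled so that it is unital when `A` is doubly balanced. -/
noncomputable def normalizedMap (A : Operator k m n) :
    Matrix (Fin n) (Fin n) ℝ →ₗ[ℝ] Matrix (Fin m) (Fin m) ℝ where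
  toFun X := (m / size A) • cpMap A X
  map_add' X Y := by
    simp only [cpMap, Matrix.mul_add, Matrix.add_mul, Finset.sum_add_distrib, smul_add]
  map_smul' c X := by
    simp only [cpMap, Matrix.mul_smul, Matrix.smul_mul, ← Finset.smul_sum, smul_comm c,
      RingHom.id_apply]

theorem normalizedMap_apply (X : Matrix (Fin n) (Fin n) ℝ) :
    normalizedMap A X = (m / size A) • cpMap A X := rfl

theorem normalizedMap_transpose_apply (Y : Matrix (Fin m) (Fin m) ℝ) :
    normalizedMap A.transpose Y = (n / size A) • cpMapAdjoint A Y := by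
  rw [normalizedMap_apply, cpMap_transpose, size_transpose]

theorem IsNearlyDoublyBalanced.isNearlyUnital_normalizedMap [NeZero m]
    (h : IsNearlyDoublyBalanced A ε) (hs : 0 < size A) :
    IsNearlyUnital (normalizedMap A) ε := by
  have hscale : (0 : ℝ) ≤ m / size A := by positivity
  have hcancel (c : ℝ) : m / size A * (c * (size A / m)) = c := by
    have := NeZero.ne (m : ℝ)
    field_simp
  refine ⟨fun X hX => smul_nonneg hscale (cpMap_nonneg A hX), ?_, ?_⟩
  · have := smul_le_smul_of_nonneg_left (Matrix.le_iff.2 h.left_lower) hscale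
    rwa [smul_smul, hcancel] at this
  · have := smul_le_smul_of_nonneg_left (Matrix.le_iff.2 h.left_upper) hscale
    rwa [smul_smul, hcancel] at this

theorem inner_normalizedMap [NeZero m] (Y : Matrix (Fin m) (Fin m) ℝ)
    (X : Matrix (Fin n) (Fin n) ℝ) :
    ⟪Y, normalizedMap A X⟫ = (Yᵀ * cpMap A X).trace / size A := by
  have := NeZero.ne (m : ℝ)
  rw [normalizedMap_apply, real_inner_smul_right, inner_eq_trace, Fintype.card_fin]
  field_simp

theorem inner_normalizedMap_eq_inner_normalizedMap_transpose [NeZero m] [NeZero n]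
    (Y : Matrix (Fin m) (Fin m) ℝ) (X : Matrix (Fin n) (Fin n) ℝ) :
    ⟪Y, normalizedMap A X⟫ = ⟪normalizedMap A.transpose Y, X⟫ := by
  rw [real_inner_comm X, inner_normalizedMap, inner_normalizedMap, trace_transpose_mul_cpMap,
    cpMap_transpose, size_transpose, ← Matrix.trace_transpose, Matrix.transpose_mul,
    Matrix.transpose_transpose]

theorem inner_one_normalizedMap_one [NeZero m] (hs : 0 < size A) :
    ⟪1, normalizedMap A 1⟫ = 1 := by
  rw [inner_normalizedMap, Matrix.transpose_one, one_mul, trace_cpMap_one, div_self hs.ne']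

theorem inner_normalizedMap_sq_le [NeZero m] [NeZero n] (Y : Matrix (Fin m) (Fin m) ℝ)
    (X : Matrix (Fin n) (Fin n) ℝ) :
    ⟪Y, normalizedMap A X⟫ ^ 2 ≤
      ⟪Y, normalizedMap A 1 * Y⟫ * ⟪Xᵀ, normalizedMap A.transpose 1 * Xᵀ⟫ := by
  have := NeZero.ne (m : ℝ)
  have := NeZero.ne (n : ℝ)
  rw [inner_normalizedMap, normalizedMap_apply, normalizedMap_transpose_apply, smul_mul_assoc,
    smul_mul_assoc, real_inner_smul_right, real_inner_smul_right, inner_eq_trace, inner_eq_trace,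
    Fintype.card_fin, Fintype.card_fin, Matrix.transpose_transpose, div_pow]
  calc (Yᵀ * cpMap A X).trace ^ 2 / size A ^ 2
      ≤ (Yᵀ * (cpMap A 1 * Y)).trace * (X * (cpMapAdjoint A 1 * Xᵀ)).trace / size A ^ 2 := by
        gcongr
        exact trace_transpose_mul_cpMap_sq_le A Y X
    _ = _ := by field_simp

theorem IsNearlyUnital.abs_inner_map_one_mul_le {ι κ : Type*} [Fintype ι] [DecidableEq ι]
    [DecidableEq κ] {Φ : Matrix κ κ ℝ →ₗ[ℝ] Matrix ι ι ℝ} (h : IsNearlyUnital Φ ε) (hε : 0 ≤ ε)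
    (Y : Matrix ι ι ℝ) : |⟪Y, Φ 1 * Y⟫| ≤ (1 + ε) * ‖Y‖ ^ 2 := by
  have hlower : -((1 + ε) • 1) ≤ Φ 1 := by
    rw [← neg_smul]
    exact (smul_le_smul_of_nonneg_right (by linarith) zero_le_one).trans h.lower
  calc |⟪Y, Φ 1 * Y⟫| ≤ ‖Y‖ * ‖Φ 1 * Y‖ := abs_real_inner_le_norm _ _
    _ ≤ ‖Y‖ * ((1 + ε) * ‖Y‖) := by
        gcongr
        exact norm_mul_le_of_le (by linarith) hlower h.upper Y
    _ = (1 + ε) * ‖Y‖ ^ 2 := by ring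

theorem IsNearlyDoublyBalanced.norm_normalizedMap_le [NeZero m] [NeZero n]
    (h : IsNearlyDoublyBalanced A ε) (hε : 0 ≤ ε) (hs : 0 < size A)
    (X : Matrix (Fin n) (Fin n) ℝ) : ‖normalizedMap A X‖ ≤ (1 + ε) * ‖X‖ := by
  set Y := normalizedMap A X with hY
  have hleft := (h.isNearlyUnital_normalizedMap hs).abs_inner_map_one_mul_le hε Y
  have hright := (h.transpose.isNearlyUnital_normalizedMap
    (hs.trans_eq (size_transpose A).symm)).abs_inner_map_one_mul_le hε Xᵀ
  rw [norm_transpose] at hright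
  have hsq : (‖Y‖ * ‖Y‖) ^ 2 ≤ ((1 + ε) * ‖X‖ * ‖Y‖) ^ 2 := by
    calc (‖Y‖ * ‖Y‖) ^ 2
        = ⟪Y, normalizedMap A X⟫ ^ 2 := by rw [← hY, real_inner_self_eq_norm_mul_norm]
      _ ≤ ⟪Y, normalizedMap A 1 * Y⟫ * ⟪Xᵀ, normalizedMap A.transpose 1 * Xᵀ⟫ :=
        inner_normalizedMap_sq_le Y X
      _ ≤ (1 + ε) * ‖Y‖ ^ 2 * ((1 + ε) * ‖X‖ ^ 2) :=
        (le_abs_self _).trans ((abs_mul _ _).trans_le (by gcongr))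
      _ = ((1 + ε) * ‖X‖ * ‖Y‖) ^ 2 := by ring
  rcases (norm_nonneg Y).eq_or_lt with hY0 | hY0
  · exact hY0 ▸ by positivity
  · exact le_of_mul_le_mul_right (abs_le_of_sq_le_sq' hsq (by positivity)).2 hY0

theorem IsNearlyDoublyBalanced.isBalancedPair [NeZero m] [NeZero n]
    (h : IsNearlyDoublyBalanced A ε) (hε : 0 ≤ ε) (hs : 0 < size A) :
    IsBalancedPair (normalizedMap A) (normalizedMap A.transpose) ε where
  eps_nonneg := hε
  left := h.isNearlyUnital_normalizedMap hs
  right := h.transpose.isNearlyUnital_normalizedMap (hs.trans_eq (size_transpose A).symm)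
  inner_map := inner_normalizedMap_eq_inner_normalizedMap_transpose
  inner_one_map_one := inner_one_normalizedMap_one hs
  norm_map_le := h.norm_normalizedMap_le hε hs

end NormalizedMap

section SpectralGap

variable {k m n : ℕ} {A : Operator k m n} {ε lam : ℝ}

theorem matrixRep_mulVec_vec (A : Operator k m n) (X : Matrix (Fin n) (Fin n) ℝ) :
    matrixRep A *ᵥ X.vec = (cpMap A X).vec := by
  simp only [matrixRep, cpMap, Matrix.sum_mulVec, Matrix.vec_sum, Matrix.kronecker_mulVec_vec]

/-- `Matrix.vec` as a linear map into a Euclidean space. -/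
def vecLinear {ι : Type*} : Matrix ι ι ℝ →ₗ[ℝ] EuclideanSpace ℝ (ι × ι) where
  toFun X := WithLp.toLp 2 X.vec
  map_add' _ _ := rfl
  map_smul' _ _ := rfl

theorem norm_vecLinear {ι : Type*} [Fintype ι] [DecidableEq ι] [Nonempty ι] (X : Matrix ι ι ℝ) :
    ‖vecLinear X‖ = √(Fintype.card ι) * ‖X‖ := by
  have hcard : (Fintype.card ι : ℝ) ≠ 0 := Nat.cast_ne_zero.2 Fintype.card_ne_zero
  rw [← sq_eq_sq₀ (norm_nonneg _) (by positivity), mul_pow, Real.sq_sqrt (Nat.cast_nonneg _),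
    norm_sq_eq_trace, mul_div_cancel₀ _ hcard, ← Matrix.vec_dotProduct_vec,
    EuclideanSpace.real_norm_sq_eq]
  exact Finset.sum_congr rfl fun _ _ => sq _

theorem toEuclideanLin_matrixRep_vecLinear (A : Operator k m n) (X : Matrix (Fin n) (Fin n) ℝ) :
    Matrix.toEuclideanLin (matrixRep A) (vecLinear X) = vecLinear (cpMap A X) :=
  congrArg (WithLp.toLp 2) (matrixRep_mulVec_vec A X)

namespace HasSpectralGap

variable [NeZero m] [NeZero n]

theorem lam_le_one (h : HasSpectralGap A lam) (hs : 0 < size A) : lam ≤ 1 := by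
  have hm := NeZero.pos m
  have hn := NeZero.pos n
  have hscale : 0 < size A / √((m : ℝ) * n) := by positivity
  linarith [nonneg_of_mul_nonneg_left ((LinearMap.singularValues_nonneg _ 1).trans h) hscale]

theorem exists_forall_norm_normalizedMap_le (h : HasSpectralGap A lam) (hs : 0 < size A) :
    ∃ p : Matrix (Fin n) (Fin n) ℝ →ₗ[ℝ] ℝ,
      ∀ W, p W = 0 → ‖normalizedMap A W‖ ≤ (1 - lam) * ‖W‖ := by
  have hm := NeZero.pos m
  have hn := NeZero.pos n
  obtain ⟨v, hv⟩ := exists_forall_inner_eq_zero_norm_le (Matrix.toEuclideanLin (matrixRep A))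
  refine ⟨(innerSL ℝ v).toLinearMap ∘ₗ vecLinear, fun W hW => ?_⟩
  have hcp : √m * ‖cpMap A W‖ ≤ (1 - lam) * (size A / √(m * n)) * (√n * ‖W‖) := by
    have := (hv _ hW).trans (mul_le_mul_of_nonneg_right h (norm_nonneg _))
    rwa [toEuclideanLin_matrixRep_vecLinear, norm_vecLinear, norm_vecLinear, Fintype.card_fin,
      Fintype.card_fin] at this
  calc ‖normalizedMap A W‖ = √m / size A * (√m * ‖cpMap A W‖) := by
        rw [normalizedMap_apply, norm_smul, Real.norm_of_nonneg (by positivity), ← mul_assoc,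
          div_mul_eq_mul_div √m, Real.mul_self_sqrt (Nat.cast_nonneg m)]
    _ ≤ √m / size A * ((1 - lam) * (size A / √(m * n)) * (√n * ‖W‖)) := by gcongr
    _ = (1 - lam) * ‖W‖ := by
        rw [Real.sqrt_mul (Nat.cast_nonneg m)]
        field_simp

theorem isGappedPair (h : HasSpectralGap A lam) (hA : IsNearlyDoublyBalanced A ε) (hε0 : 0 ≤ ε)
    (hlam : 0 < lam) (hε : ε ≤ 9 / 10 * lam / 1000) (hs : 0 < size A) :
    IsGappedPair (normalizedMap A) (normalizedMap A.transpose) ε (9 / 10 * lam) where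
  toIsBalancedPair := hA.isBalancedPair hε0 hs
  gap_pos := by positivity
  gap_le_one := by linarith [h.lam_le_one hs]
  eps_le := hε
  norm_map_le_of_inner_one_eq_zero D hD := by
    obtain ⟨p, hp⟩ := h.exists_forall_norm_normalizedMap_le hs
    exact (hA.isBalancedPair hε0 hs).norm_map_le_of_inner_one_eq_zero hlam (h.lam_le_one hs)
      (by linarith) hp hD

end HasSpectralGap

end SpectralGap

section Capacity

variable {k m n : ℕ} {A : Operator k m n} {ε lam ψ : ℝ}

theorem capacity_le_size [NeZero m] (A : Operator k m n) : capacity A ≤ size A := by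
  have hm : (0 : ℝ) < m := Nat.cast_pos.2 (NeZero.pos m)
  refine (ciInf_le (capacity_bddBelow A) ⟨1, Matrix.PosDef.one⟩).trans ?_
  have amgm := det_rpow_inv_card_le_trace_div (Matrix.nonneg_iff_posSemidef.1
    (cpMap_nonneg A zero_le_one))
  rw [trace_cpMap_one, Fintype.card_fin, le_div_iff₀' hm] at amgm
  simpa only [Matrix.det_one, Real.one_rpow, div_one] using amgm

theorem capacity_nonneg (A : Operator k m n) : 0 ≤ capacity A := by
  refine Real.iInf_nonneg fun X => ?_
  have hdet := (Matrix.nonneg_iff_posSemidef.1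
    (cpMap_nonneg A (Matrix.nonneg_iff_posSemidef.2 X.2.posSemidef))).det_nonneg
  have hXdet := X.2.det_pos
  positivity

theorem card_mul_det_cpMap_rpow [NeZero m] (hs : 0 < size A) {X : Matrix (Fin n) (Fin n) ℝ}
    (hX : (normalizedMap A X).PosDef) :
    m * (cpMap A X).det ^ (1 / (m : ℝ)) =
      size A * (normalizedMap A X).det ^ (1 / (m : ℝ)) := by
  have hm : (0 : ℝ) < m := Nat.cast_pos.2 (NeZero.pos m)
  have hcp : cpMap A X = (size A / m) • normalizedMap A X := by
    rw [normalizedMap_apply, smul_smul, div_mul_div_cancel₀ hm.ne', div_self hs.ne', one_smul]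
  rw [hcp, Matrix.det_smul, Fintype.card_fin, Real.mul_rpow (by positivity) hX.det_pos.le,
    one_div, Real.pow_rpow_inv_natCast (by positivity) (NeZero.ne m), ← mul_assoc,
    mul_div_cancel₀ _ hm.ne']

theorem size_mul_exp_neg_le_capacity [NeZero m] (hs : 0 < size A)
    (h : ∀ X : Matrix (Fin n) (Fin n) ℝ, X.PosDef → (normalizedMap A X).PosDef ∧
      Real.log X.det / n - ψ ≤ Real.log (normalizedMap A X).det / m) :
    size A * Real.exp (-ψ) ≤ capacity A := by
  have : Nonempty {X : Matrix (Fin n) (Fin n) ℝ // X.PosDef} := ⟨⟨1, Matrix.PosDef.one⟩⟩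
  refine le_ciInf fun ⟨X, hX⟩ => ?_
  obtain ⟨hΦX, hlog⟩ := h X hX
  rw [card_mul_det_cpMap_rpow hs hΦX, mul_div_assoc, Real.rpow_def_of_pos hΦX.det_pos,
    Real.rpow_def_of_pos hX.det_pos, ← Real.exp_sub, mul_one_div, mul_one_div]
  gcongr
  linarith

theorem one_sub_mul_size_le_capacity [NeZero m] (hs : 0 < size A)
    (h : IsBalancedPair (normalizedMap A) (normalizedMap A.transpose) ε)
    (hscaling : ∃ X Y, X.PosDef ∧ Y.PosDef ∧ normalizedMap A X = Y⁻¹ ∧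
      normalizedMap A.transpose Y = X⁻¹ ∧
      Real.log X.det / Fintype.card (Fin n) + Real.log Y.det / Fintype.card (Fin m) ≤ ψ) :
    (1 - ψ) * size A ≤ capacity A := by
  obtain ⟨X₀, Y₀, hX₀, hY₀, hΦ, hΨ, hψ⟩ := hscaling
  calc (1 - ψ) * size A ≤ size A * Real.exp (-ψ) := by
        rw [mul_comm]
        gcongr
        exact Real.one_sub_le_exp_neg ψ
    _ ≤ capacity A := by
        refine size_mul_exp_neg_le_capacity hs fun X hX => ?_
        obtain ⟨hΦX, hlog⟩ :=
          log_det_sub_le_log_det_map h.left.map_nonneg h.inner_map hX₀ hY₀ hΦ hΨ hX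
        simp only [Fintype.card_fin] at hlog hψ
        exact ⟨hΦX, by linarith⟩

-- After `K` Sinkhorn steps the drift `ε K` is still negligible, while the accumulated contraction
-- `exp (-μ K / 2)` has absorbed the factor `√x` between the trace norm and the operator norm.
theorem exists_iteration_count {x μ : ℝ} (hx : 2 ≤ x) (hε : 0 ≤ ε) (hμ0 : 0 < μ) (hμ1 : μ ≤ 1)
    (h : 80000 * ε * Real.log x ≤ μ ^ 2) :
    51200 * ε ≤ μ ^ 2 ∧ ∃ K : ℕ, 1600 * (ε * K) ≤ μ ∧ √x ≤ Real.exp (μ / 2 * K) := by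
  have hlog : 0.69 ≤ Real.log x := by
    linarith [Real.log_two_gt_d9, Real.log_le_log two_pos hx]
  have hεμ : 51200 * ε ≤ μ ^ 2 := by nlinarith
  refine ⟨hεμ, ⌈Real.log x / μ⌉₊, ?_, ?_⟩
  · have hceil : (⌈Real.log x / μ⌉₊ : ℝ) ≤ Real.log x / μ + 1 :=
      (Nat.ceil_lt_add_one (by positivity)).le
    have hdrift : ε * (Real.log x / μ) ≤ μ / 80000 := by
      rw [mul_div_assoc', div_le_iff₀ hμ0]
      linarith
    nlinarith [mul_le_mul_of_nonneg_left hceil hε]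
  · have hceil := (div_le_iff₀ hμ0).1 (Nat.le_ceil (Real.log x / μ))
    rw [← Real.exp_log (show 0 < √x by positivity), Real.log_sqrt (by linarith)]
    gcongr
    linarith

theorem le_capacity_of_two_le [NeZero m] [NeZero n] (hm : 2 ≤ m) (hε : 0 ≤ ε) (hlam : 0 < lam)
    (hs : 0 < size A) (hA : IsNearlyDoublyBalanced A ε) (hgap : HasSpectralGap A lam)
    (h : 100000 * ε * Real.log m ≤ lam ^ 2) :
    (1 - 4 * ε ^ 2 / lam) * size A ≤ capacity A := by
  have hlam1 := hgap.lam_le_one hs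
  obtain ⟨hεlam, K, hK, hcard⟩ := exists_iteration_count (Nat.ofNat_le_cast.2 hm) hε
    (by positivity : 0 < 9 / 10 * lam) (by linarith) (by nlinarith)
  have hP := hgap.isGappedPair hA hε hlam (by nlinarith) hs
  obtain ⟨X, Y, hX, hY, hΦ, hΨ, hψ⟩ := hP.exists_scaling hK (by rwa [Fintype.card_fin]) hεlam
  refine one_sub_mul_size_le_capacity hs hP.toIsBalancedPair
    ⟨X, Y, hX, hY, hΦ, hΨ, hψ.trans ?_⟩
  rw [div_le_div_iff₀ (by positivity) hlam]
  nlinarith [mul_nonneg (sq_nonneg ε) hlam.le]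

theorem IsBalancedPair.exists_scaling_of_unique {ι κ : Type*} [Fintype ι] [Fintype κ]
    [DecidableEq ι] [DecidableEq κ] [Unique ι] [Nonempty κ] {Φ : Matrix κ κ ℝ →ₗ[ℝ] Matrix ι ι ℝ}
    {Ψ : Matrix ι ι ℝ →ₗ[ℝ] Matrix κ κ ℝ} (h : IsBalancedPair Φ Ψ ε) (hε : ε ≤ 1 / 2) :
    ∃ X Y, X.PosDef ∧ Y.PosDef ∧ Φ X = Y⁻¹ ∧ Ψ Y = X⁻¹ ∧
      Real.log X.det / Fintype.card κ + Real.log Y.det / Fintype.card ι ≤ 2 * ε ^ 2 := by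
  have hε0 := h.eps_nonneg
  have hΨ : (Ψ 1).PosDef := posDef_of_smul_one_le (by linarith) h.right.lower
  have hdet := hΨ.det_pos.ne'.isUnit
  have hΦ : Φ (Ψ 1)⁻¹ = 1 := by
    have : ⟪1, Φ (Ψ 1)⁻¹⟫ = 1 := by
      rw [h.inner_map, inner_inv_right_eq_one hΨ]
    ext i j
    rw [Subsingleton.elim i default, Subsingleton.elim j default]
    simpa [inner_one_left_eq_trace, Matrix.trace] using this
  refine ⟨(Ψ 1)⁻¹, 1, hΨ.inv, Matrix.PosDef.one, by rw [hΦ, inv_one],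
    (Matrix.nonsing_inv_nonsing_inv _ hdet).symm, ?_⟩
  have hquad := (abs_le.1 (abs_log_det_sub_quadratic_le hε h.right.lower h.right.upper)).1
  rw [inner_sub_right, h.symm.inner_one_map_one, real_inner_self_eq_norm_sq, norm_one_eq_one]
    at hquad
  rw [Matrix.det_one, Real.log_one, zero_div, add_zero, Matrix.det_nonsing_inv,
    Ring.inverse_eq_inv, Real.log_inv, neg_div]
  nlinarith [pow_le_pow_left₀ (norm_nonneg _) (h.right.norm_map_one_sub_one_le hε0) 2]

theorem le_capacity_of_eq_one [NeZero n] {A : Operator k 1 n} (hε : 0 ≤ ε) (hlam : 0 < lam)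
    (hs : 0 < size A) (hA : IsNearlyDoublyBalanced A ε) (hgap : HasSpectralGap A lam) :
    (1 - 4 * ε ^ 2 / lam) * size A ≤ capacity A := by
  have hlam1 := hgap.lam_le_one hs
  have hquad : 4 * ε ^ 2 ≤ 4 * ε ^ 2 / lam := le_div_self (by positivity) hlam hlam1
  rcases le_or_gt ε (1 / 2) with hε' | hε'
  · have hP := hA.isBalancedPair hε hs
    obtain ⟨X, Y, hX, hY, hΦ, hΨ, hψ⟩ := hP.exists_scaling_of_unique hε'
    exact one_sub_mul_size_le_capacity hs hP ⟨X, Y, hX, hY, hΦ, hΨ, by nlinarith [sq_nonneg ε]⟩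
  · exact (mul_nonpos_of_nonpos_of_nonneg (by nlinarith) hs.le).trans (capacity_nonneg A)

end Capacity

end OperatorScaling

theorem theoremt_general :
    ∃ C : ℝ, 0 < C ∧
      ∀ (k m n : ℕ), 1 ≤ m → 1 ≤ n →
        ∀ (A : OperatorScaling.Operator k m n) (ε lam : ℝ),
          0 ≤ ε → 0 < lam →
          OperatorScaling.IsNearlyDoublyBalanced A ε →
          OperatorScaling.HasSpectralGap A lam →
          C * ε * Real.log m ≤ lam ^ 2 →
          OperatorScaling.capacity A ≤ OperatorScaling.size A ∧
          (1 - 4 * ε ^ 2 / lam) * OperatorScaling.size A ≤ OperatorScaling.capacity A := by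
  refine ⟨100000, by norm_num, fun k m n hm hn A ε lam hε hlam hA hgap h => ?_⟩
  have : NeZero m := ⟨by omega⟩
  have : NeZero n := ⟨by omega⟩
  refine ⟨OperatorScaling.capacity_le_size A, ?_⟩
  rcases (OperatorScaling.size_nonneg A).eq_or_lt with hs | hs
  · rw [← hs, mul_zero]
    exact OperatorScaling.capacity_nonneg A
  rcases hm.eq_or_lt with rfl | hm
  · exact OperatorScaling.le_capacity_of_eq_one hε hlam hs hA hgap
  · exact OperatorScaling.le_capacity_of_two_le hm hε hlam hs hA hgap h

theorem theoremt :
    ∃ C : ℝ, 0 < C ∧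
      ∀ (k m n : ℕ), 1 ≤ m → m ≤ n →
        ∀ (A : OperatorScaling.Operator k m n) (ε lam : ℝ),
          0 ≤ ε → 0 < lam →
          OperatorScaling.IsNearlyDoublyBalanced A ε →
          OperatorScaling.HasSpectralGap A lam →
          C * ε * Real.log m ≤ lam ^ 2 →
          OperatorScaling.capacity A ≤ OperatorScaling.size A ∧
          (1 - 4 * ε ^ 2 / lam) * OperatorScaling.size A ≤ OperatorScaling.capacity A := by
  obtain ⟨C, hC, h⟩ := theoremt_general
  exact ⟨C, hC, fun k m n hm hmn => h k m n hm (hm.trans hmn)⟩
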